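/- Consider scheduling $m$ tasks on $n\ge 2$ machines, where $m\ge 2(n-1)$. The cost of machine $i$ is a set function $t_i:2^{[m]}\to\mathbb R_{\ge 0}$ with $t_i(\emptyset)=0$ and $t_i(S)\le t_i(T)$ for $S\subseteq T$. It is additive if $t_i(S)=\sum_{j\in S}t_i(\{j\})$ for all $S$; submodular if $t_i(S\cup T)+t_i(S\cap T)\le t_i(S)+t_i(T)$ for all $S,T$; and $\epsilon$-additive if $\bigl|t_i(S)-\sum_{j\in S}t_i(\{j\})\bigr|\le\epsilon$ for all $S$. A deterministic (direct revelation) mechanism maps every reported profile $b=(b_1,\dots,b_n)$ of cost functions to an allocation, that is, a partition of all the tasks into bundles $A_1(b),\dots,A_n(b)$ (possibly empty), and to payments $P_1(b),\dots,P_n(b)\in\mathbb R$ to the machines. For given sets $\mathcal T_i$ of possible cost functions of the machines, it is truthful if $$P_i(t_i,b_{-i})-t_i(A_i(t_i,b_{-i}))\ \ge\ P_i(t_i',b_{-i})-t_i(A_i(t_i',b_{-i}))$$ for all machines $i$, all $t_i,t_i'\in\mathcal T_i$ and all $b_{-i}\in\prod_{k\ne i}\mathcal T_k$. It is $c$-approximate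 on a set of profiles if $\max_i t_i(A_i(t))\le c\cdot\min_{B}\max_i t_i(B_i)$ for every profile $t$ in the set, where $B$ ranges over all allocations. 1. If a deterministic mechanism is truthful when all machines may have arbitrary submodular costs, and is $c$-approximate on all profiles of submodular costs, then $c\ge\sqrt{n-1}$. 2. More strongly, fix a machine $k$. If a deterministic mechanism is truthful when machine $k$ may have an arbitrary submodular cost and all the other machines have additive costs, and is $c$-approximate on all profiles of additive costs, then $c\ge\sqrt{n-1}$. 3. Let moreover $\epsilon>0$. The conclusion of 2 remains true if the mechanism is required to be truthful only when the cost of machine $k$ is both submodular and $\epsilon$-additive and all the other machines have additive costs. 4. The same holds if in 3 "$\epsilon$-additive" is replaced by the multiplicative condition $(1-\epsilon)\sum_{j\in S}t_k(\{j\})\le t_k(S)\le(1+\epsilon)\sum_{j\in S}t_k(\{j\})$ for all $S$. -/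

import Mathlib

namespace Scheduling

/-- A cost function on sets of the `m` tasks. -/
abbrev Cost (m : ℕ) : Type := Finset (Fin m) → ℝ

/-- A profile of cost functions, one for each of the `n` machines. -/
abbrev Profile (n m : ℕ) : Type := Fin n → Cost m

/-- An allocation of all tasks: `a j` is the machine that processes task `j`. -/
abbrev Allocation (n m : ℕ) : Type := Fin m → Fin n

/-- The set of tasks that machine `i` receives. -/
def Allocation.bundle {n m : ℕ} (a : Allocation n m) (i : Fin n) : Finset (Fin m) :=
  Finset.univ.filter fun j => a j = i

/-- Normalized and monotone (hence non-negative) cost functions. -/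
def IsCost {m : ℕ} (v : Cost m) : Prop :=
  v ∅ = 0 ∧ ∀ S T : Finset (Fin m), S ⊆ T → v S ≤ v T

/-- Additive cost functions (with non-negative processing times). -/
def IsAdditive {m : ℕ} (v : Cost m) : Prop :=
  IsCost v ∧ ∀ S : Finset (Fin m), v S = ∑ j ∈ S, v {j}

/-- Normalized monotone submodular cost functions. -/
def IsSubmodular {m : ℕ} (v : Cost m) : Prop :=
  IsCost v ∧ ∀ S T : Finset (Fin m), v (S ∪ T) + v (S ∩ T) ≤ v S + v T

/-- The cost of every set is within `ε` of the sum of the costs of its tasks. -/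
def IsEpsAdditive {m : ℕ} (ε : ℝ) (v : Cost m) : Prop :=
  ∀ S : Finset (Fin m), ∑ j ∈ S, v {j} - ε ≤ v S ∧ v S ≤ ∑ j ∈ S, v {j} + ε

/-- The cost of every set is within a factor `1 ± ε` of the sum of the costs of its tasks. -/
def IsMulEpsAdditive {m : ℕ} (ε : ℝ) (v : Cost m) : Prop :=
  ∀ S : Finset (Fin m),
    (1 - ε) * ∑ j ∈ S, v {j} ≤ v S ∧ v S ≤ (1 + ε) * ∑ j ∈ S, v {j}

/-- A deterministic direct revelation mechanism: an allocation algorithm and payments handed to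
the machines, both depending on the reported profile. Only its behaviour on the domain under
consideration matters; elsewhere it is unconstrained. -/
structure Mechanism (n m : ℕ) where
  alloc : Profile n m → Allocation n m
  pay : Profile n m → Fin n → ℝ

/-- The utility of machine `i` with true cost `v` when the profile `b` is reported. -/
def Mechanism.utility {n m : ℕ} (M : Mechanism n m) (i : Fin n) (v : Cost m)
    (b : Profile n m) : ℝ :=
  M.pay b i - v ((M.alloc b).bundle i)

/-- Truthfulness when the possible types of machine `i` form the set `D i`: whatever the others
report, reporting the true type is at least as good as reporting any other type. In `b`, the
entry `b i` is the true type of machine `i`. -/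
def Mechanism.TruthfulOn {n m : ℕ} (M : Mechanism n m) (D : Fin n → Set (Cost m)) : Prop :=
  ∀ (i : Fin n) (b : Profile n m), (∀ k, b k ∈ D k) → ∀ v ∈ D i,
    M.utility i (b i) (Function.update b i v) ≤ M.utility i (b i) b

/-- The maximum completion time of a machine. -/
noncomputable def makespan {n m : ℕ} (t : Profile n m) (a : Allocation n m) : ℝ :=
  ⨆ i : Fin n, t i (a.bundle i)

/-- The minimum makespan over all allocations. -/
noncomputable def opt {n m : ℕ} (t : Profile n m) : ℝ :=
  ⨅ a : Allocation n m, makespan t a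

/-- The mechanism is `c`-approximate on the profiles with types in `D`. -/
def Mechanism.ApproxOn {n m : ℕ} (M : Mechanism n m) (c : ℝ) (D : Fin n → Set (Cost m)) : Prop :=
  ∀ t : Profile n m, (∀ k, t k ∈ D k) → makespan t (M.alloc t) ≤ c * opt t

/-- Every machine has an additive cost function. -/
def additiveDomain (n m : ℕ) : Fin n → Set (Cost m) :=
  fun _ => {v | IsAdditive v}

/-- Every machine has a submodular cost function. -/
def submodularDomain (n m : ℕ) : Fin n → Set (Cost m) :=
  fun _ => {v | IsSubmodular v}

/-- Machine `k` has a cost function in the class `C`, every other machine is additive. -/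
def oneMachineDomain {n m : ℕ} (k : Fin n) (C : Set (Cost m)) : Fin n → Set (Cost m) :=
  fun i => {v | (i = k → v ∈ C) ∧ (i ≠ k → IsAdditive v)}

end Scheduling

/-!
Call the machine `k` the root and the other machines leaves, and let each leaf own a first and a
second task. A leaf `i` has costs `(x_i, y_i)` for its own tasks and a prohibitive cost for all
others; the root has cost `γ` for the first tasks of the leaves in `J` and a tiny cost for
everything else. By induction on `J` the root receives all the tasks. Once `J` contains all leaves,
with `γ` equal to `1` and all `x_i` close to some `x₀ > c`, the root has load at least `n - 1`,
whereas handing the first tasks to their owners gives a makespan of about `x₀`. Hence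
`n - 1 ≤ c * x₀`, and `n - 1 ≤ c ^ 2` in the limit.

In the induction step everything is fixed except the root's costs for the two tasks of one leaf `i`,
the costs `(x, y)` of this leaf, and the set of machines for which the second task is free.
Truthfulness for the root says that its behaviour is determined by a gain, the value of the first
task to it, which is monotone in `x`, and a rent, the value of the second task, which is monotone in
`y`. A submodular root for which the first task is free on top of the second gets both tasks or
none, according to whether gain plus rent exceeds its cost `β`. If the root refused the first task,
the gain would be bounded, so that on a fine mesh of points `(x, y)` the curve where gain plus rent
crosses `β` would stay in one short block of rows for a suitable `β`. Whether a machine other than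
the root and `i` gets the first task does not depend on whether the second task is free to it, so by
parity the leaf `i` itself gains or loses the first task where the curve is crossed. By weak
monotonicity all changes of one kind lie along one line of slope `1` or `-1`, and there are finitely
many kinds, whereas the curve is crossed on many distant antidiagonals: a contradiction. The
remaining leaves have generic costs, which keeps them from changing their minds about the first task
when the second one becomes free to them.
-/

namespace Scheduling

open Finset

/-! ### Parity of toggle-invariant maps -/

section Parity

variable {α : Type*} [DecidableEq α]

/-- `f` names an element of `α` for every set, and an element of `O` outside `σ` is named at `σ`
exactly when it is named at `insert z σ`. It describes who receives a task when `σ` is the set of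
machines that can process another task for free. -/
def ToggleInvariant (O : Finset α) (f : Finset α → α) : Prop :=
  ∀ z ∈ O, ∀ σ, z ∉ σ → (f σ = z ↔ f (insert z σ) = z)

lemma even_card_filter_powerset {O : Finset α} {z : α} (hz : z ∈ O) {p : Finset α → Prop}
    [DecidablePred p] (hp : ∀ σ, z ∉ σ → (p σ ↔ p (insert z σ))) :
    Even #{σ ∈ O.powerset | p σ} := by
  rw [← insert_erase hz, card_filter, sum_powerset_insert (notMem_erase z O)]
  refine ⟨∑ σ ∈ (O.erase z).powerset, if p σ then 1 else 0, congrArg _ ?_⟩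
  refine sum_congr rfl fun σ hσ => if_congr (hp σ fun h => ?_).symm rfl rfl
  exact notMem_erase z O (mem_powerset.1 hσ h)

lemma ToggleInvariant.even_card_filter_mem {O : Finset α} {f : Finset α → α}
    (hf : ToggleInvariant O f) : Even #{σ ∈ O.powerset | f σ ∈ O} := by
  rw [card_eq_sum_card_fiberwise (s := {σ ∈ O.powerset | f σ ∈ O}) (f := f) (t := O)
    fun σ hσ => (mem_filter.1 hσ).2]
  refine even_sum _ fun z hz => ?_
  have hfiber : {σ ∈ {σ ∈ O.powerset | f σ ∈ O} | f σ = z} = {σ ∈ O.powerset | f σ = z} := by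
    rw [filter_filter]
    exact filter_congr fun σ _ => ⟨And.right, fun h => ⟨h ▸ hz, h⟩⟩
  exact hfiber ▸ even_card_filter_powerset hz (hf z hz)

lemma ToggleInvariant.exists_eq_iff_ne [Fintype α] {i k : α} (hik : i ≠ k) {u v : Finset α → α}
    (hu : ToggleInvariant {k, i}ᶜ u) (hv : ToggleInvariant {k, i}ᶜ v)
    (huk : ∀ σ ⊆ {k, i}ᶜ, u σ ≠ k) (hvk : ∀ σ ⊆ {k, i}ᶜ, σ.Nonempty → v σ ≠ k)
    (hv₀ : v ∅ = k) : ∃ σ, ¬(u σ = i ↔ v σ = i) := by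
  by_contra! hiff
  have hmem (z : α) : z ∈ ({k, i}ᶜ : Finset α) ↔ z ≠ k ∧ z ≠ i := by simp
  have hinsert : {σ ∈ powerset {k, i}ᶜ | u σ ∈ ({k, i}ᶜ : Finset α)} =
      insert ∅ {σ ∈ powerset {k, i}ᶜ | v σ ∈ ({k, i}ᶜ : Finset α)} := by
    ext σ
    simp only [mem_insert, mem_filter, mem_powerset, hmem]
    rcases σ.eq_empty_or_nonempty with rfl | hσ
    · have hu₀ : u ∅ ≠ i := fun h => hik ((hiff ∅).1 h ▸ hv₀)
      simpa [hu₀] using huk ∅ (empty_subset _)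
    · simp only [hσ.ne_empty, false_or]
      exact and_congr_right fun h => by simp [huk σ h, hvk σ h hσ, hiff σ]
  have hcard := hu.even_card_filter_mem
  rw [hinsert, card_insert_of_notMem (by simp [hv₀])] at hcard
  exact Nat.not_even_iff_odd.2 hv.even_card_filter_mem.add_one hcard

end Parity

/-! ### Counting and pigeonhole lemmas -/

section Counting

lemma exists_apply_mem_Icc_of_le_add {f : ℕ → ℕ} {a b s t : ℕ} (hab : a ≤ b) (ha : f a ≤ t)
    (hb : t ≤ f b) (hstep : ∀ j ∈ Set.Ico a b, f (j + 1) ≤ f j + s) :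
    ∃ j ∈ Set.Icc a b, f j ∈ Set.Icc t (t + s) := by
  classical
  have hex : ∃ j, a ≤ j ∧ t ≤ f j := ⟨b, hab, hb⟩
  obtain ⟨haj, htj⟩ := Nat.find_spec hex
  have hjb : Nat.find hex ≤ b := Nat.find_min' hex ⟨hab, hb⟩
  refine ⟨Nat.find hex, ⟨haj, hjb⟩, htj, ?_⟩
  rcases haj.eq_or_lt with h | h
  · exact h ▸ ha.trans (Nat.le_add_right t s)
  · obtain ⟨j, hj⟩ := Nat.exists_eq_add_of_lt h
    have hlt : f (a + j) < t := by
      by_contra! hle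
      exact Nat.find_min hex (m := a + j) (by omega) ⟨by omega, hle⟩
    have := hstep (a + j) ⟨by omega, by omega⟩
    rw [hj]
    omega

lemma exists_add_lt_apply_succ {f : ℕ → ℝ} {n : ℕ} {δ : ℝ} (h : f 0 + n * δ < f n) :
    ∃ q < n, f q + δ < f (q + 1) := by
  by_contra! hle
  have hsum := sum_le_card_nsmul (range n) (fun q => f (q + 1) - f q) δ fun q hq =>
    sub_le_iff_le_add'.2 (hle q (mem_range.1 hq))
  rw [sum_range_sub, card_range, nsmul_eq_mul] at hsum
  linarith

lemma exists_finset_mem_Ioo_notMem (B : ℝ) (N : ℕ) {s : ℝ} (hs : 0 < s) :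
    ∃ T : Finset ℝ, ∀ l ∈ Set.Icc 0 B, ∀ V : Finset ℝ, #V ≤ N → ∃ β ∈ T, β ∈ Set.Ioo l (l + s) ∧
      β ∉ V := by
  have hcell (e : ℕ) : ∃ T : Finset ℝ, ↑T ⊆ Set.Ioo ((e + 1) * (s / 2)) ((e + 2) * (s / 2)) ∧
      #T = N + 1 :=
    (Set.Ioo_infinite (by nlinarith)).exists_subset_card_eq (N + 1)
  choose T hT hcard using hcell
  refine ⟨(range (⌊B / (s / 2)⌋₊ + 1)).biUnion T, fun l ⟨hl, hlB⟩ V hV => ?_⟩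
  set e := ⌊l / (s / 2)⌋₊
  have he : e ≤ ⌊B / (s / 2)⌋₊ := Nat.floor_le_floor (by gcongr)
  have hel : e * (s / 2) ≤ l := (le_div_iff₀ (by positivity)).1 (Nat.floor_le (by positivity))
  have hle : l < (e + 1) * (s / 2) := (div_lt_iff₀ (by positivity)).1 (Nat.lt_floor_add_one _)
  obtain ⟨β, hβ, hβV⟩ := exists_mem_notMem_of_card_lt_card (s := V) (t := T e)
    (by rw [hcard]; omega)
  obtain ⟨hβl, hβu⟩ := hT e hβ
  exact ⟨β, mem_biUnion.2 ⟨e, mem_range.2 (by omega), hβ⟩, ⟨by linarith, by linarith⟩, hβV⟩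

lemma card_mul_card_le_card_fun {V ι : Type*} [Fintype V] [DecidableEq V] [Fintype ι]
    {v : V} {B : Finset (V → ι)} (hB : ∀ X ∈ B, ∀ X' ∈ B, (∀ u ≠ v, X u = X' u) → X = X') :
    #B * Fintype.card ι ≤ Fintype.card (V → ι) := by
  classical
  rw [← card_univ (α := ι), ← card_product, ← card_univ]
  refine card_le_card_of_injOn (fun p => Function.update p.1 v p.2) (fun _ _ => mem_univ _) ?_
  rintro ⟨X, q⟩ hX ⟨X', q'⟩ hX' heq
  have hq : q = q' := by simpa using congrFun heq v
  have hXX' : X = X' := hB X (mem_product.1 hX).1 X' (mem_product.1 hX').1 fun u hu => by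
    simpa [Function.update_of_ne hu] using congrFun heq u
  rw [hq, hXX']

lemma exists_forall_not_of_card_lt {V ι E : Type*} [Finite V] [Fintype ι] [Fintype E]
    (hE : Fintype.card E < Fintype.card ι) (v : E → V) (bad : E → (V → ι) → Prop)
    (hbad : ∀ e X X', (∀ u ≠ v e, X u = X' u) → bad e X → bad e X' → X = X') :
    ∃ X, ∀ e, ¬bad e X := by
  classical
  have := Fintype.ofFinite V
  by_contra! hcover
  have hcard (e : E) : #{X | bad e X} * Fintype.card ι ≤ Fintype.card (V → ι) :=
    card_mul_card_le_card_fun (v := v e) fun X hX X' hX' h =>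
      hbad e X X' h (mem_filter.1 hX).2 (mem_filter.1 hX').2
  have hunion : Fintype.card (V → ι) ≤ ∑ e, #{X | bad e X} := by
    rw [← card_univ]
    refine (card_le_card fun X _ => ?_).trans card_biUnion_le
    obtain ⟨e, he⟩ := hcover X
    exact mem_biUnion.2 ⟨e, mem_univ e, by simpa using he⟩
  have hle : Fintype.card (V → ι) * Fintype.card ι ≤ Fintype.card (V → ι) * Fintype.card E := by
    calc Fintype.card (V → ι) * Fintype.card ι
        ≤ ∑ e, #{X | bad e X} * Fintype.card ι := by rw [← sum_mul]; gcongr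
      _ ≤ ∑ _e : E, Fintype.card (V → ι) := sum_le_sum fun e _ => hcard e
      _ = Fintype.card (V → ι) * Fintype.card E := by simp [mul_comm]
  have : Nonempty ι := Fintype.card_pos_iff.1 (by omega)
  exact hE.not_ge (Nat.le_of_mul_le_mul_left hle Fintype.card_pos)

lemma exists_not_and_succ {p : ℕ → Prop} {a b : ℕ} (hab : a ≤ b) (ha : ¬p a) (hb : p b) :
    ∃ l ∈ Set.Ico a b, ¬p l ∧ p (l + 1) := by
  by_contra! h
  exact Nat.le_induction (P := fun l _ => l ≤ b → ¬p l) (fun _ => ha)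
    (fun l hal ih hlb => h l ⟨hal, hlb⟩ (ih (by omega))) b hab le_rfl hb

/-- Pigeonhole on points `(j, N j)` close to `card α + 1` antidiagonals that are far apart; as `N`
hardly climbs, two such points are not close to a common diagonal either. -/
lemma exists_eq_label_of_le_add_one {α : Type*} [Fintype α] {N : ℕ → ℕ} {L D M : ℕ}
    (hM : D + 6 * Fintype.card α + 1 ≤ M) (hN : ∀ j < M, N j ∈ Set.Ico L (L + D))
    (hstep : ∀ j j', j < j' → j' < M → N j' ≤ N j + 1) (a : ℕ → α) :
    ∃ j j', j < j' ∧ j' < M ∧ a j = a j' ∧ 1 < |((j : ℤ) + N j) - (j' + N j')| ∧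
      1 < |((j : ℤ) - N j) - (j' - N j')| := by
  have hcolumn (p : Fin (Fintype.card α + 1)) :
      ∃ j < M, j + N j ∈ Set.Icc (L + D + 6 * p) (L + D + 6 * p + 2) := by
    have h₀ := (hN 0 (by omega)).2
    have h₁ := (hN (M - 1) (by omega)).1
    obtain ⟨j, ⟨-, hj⟩, hjp⟩ := exists_apply_mem_Icc_of_le_add (f := fun j => j + N j)
      (t := L + D + 6 * p) (s := 2) (Nat.zero_le (M - 1)) (by omega) (by omega)
      fun j ⟨_, hj⟩ => by have := hstep j (j + 1) j.lt_succ_self (by omega); omega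
    exact ⟨j, by omega, hjp⟩
  choose j hjM hj using hcolumn
  obtain ⟨p, q, hpq, hapq⟩ := Fintype.exists_ne_map_eq_of_card_lt (fun p => a (j p)) (by simp)
  have hpq' := Fin.val_ne_of_ne hpq
  have hne : j p ≠ j q := fun h => by
    have hp := hj p
    have hq := hj q
    rw [h] at hp
    simp only [Set.mem_Icc] at hp hq
    omega
  wlog hlt : j p < j q generalizing p q
  · exact this q p hpq.symm hapq.symm hpq'.symm hne.symm (by omega)
  have hpqN := hstep _ _ hlt (hjM q)
  have hp := hj p
  have hq := hj q
  simp only [Set.mem_Icc] at hp hq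
  refine ⟨j p, j q, hlt, hjM q, hapq, ?_⟩
  rw [lt_abs, lt_abs]
  omega

/-- Think of `P` as the region above a staircase, and of `R j l a` as a label `a` of the corner of
the staircase in column `j`. -/
lemma exists_separated_crossings {α : Type*} [Fintype α] [Nonempty α] {P : ℕ → ℕ → Prop}
    {R : ℕ → ℕ → α → Prop} {L D M : ℕ} (hM : D + 6 * Fintype.card α + 1 ≤ M)
    (hbot : ∀ j < M, ¬P j L) (htop : ∀ j < M, P j (L + D))
    (hmono : ∀ j j' l l', j < j' → j' < M → l < l' → l' ≤ L + D → P j l → P j' l')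
    (hR : ∀ j < M, ∀ l < L + D, ¬P j l → P j (l + 1) → ∃ a, R j l a) :
    ∃ j j' l l' a, j < j' ∧ j' < M ∧ l < L + D ∧ l' < L + D ∧ R j l a ∧ R j' l' a ∧
      1 < |((j : ℤ) + l) - (j' + l')| ∧ 1 < |((j : ℤ) - l) - (j' - l')| := by
  have hcross (j : ℕ) : ∃ l a, j < M → l ∈ Set.Ico L (L + D) ∧ ¬P j l ∧ P j (l + 1) ∧ R j l a := by
    by_cases hj : j < M
    · obtain ⟨l, hl, hlP, hlP'⟩ :=
        exists_not_and_succ (Nat.le_add_right L D) (hbot j hj) (htop j hj)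
      obtain ⟨a, ha⟩ := hR j hj l hl.2 hlP hlP'
      exact ⟨l, a, fun _ => ⟨hl, hlP, hlP', ha⟩⟩
    · exact ⟨0, Classical.arbitrary α, fun h => absurd h hj⟩
  choose N a hN using hcross
  have hstep : ∀ j j', j < j' → j' < M → N j' ≤ N j + 1 := by
    intro j j' hjj' hj'
    by_contra! hlt
    exact (hN j' hj').2.1 (hmono j j' _ _ hjj' hj' hlt (hN j' hj').1.2.le
      (hN j (hjj'.trans hj')).2.2.1)
  obtain ⟨j, j', hjj', hj', haj, h⟩ :=
    exists_eq_label_of_le_add_one hM (fun j hj => (hN j hj).1) hstep a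
  have hj := hN j (hjj'.trans hj')
  exact ⟨j, j', N j, N j', a j, hjj', hj', hj.1.2, (hN j' hj').1.2, hj.2.2.2,
    haj ▸ (hN j' hj').2.2.2, h⟩

end Counting

/-! ### Two tasks, the root and a leaf -/

section PairModel

/-- The type of the root on two tasks: its costs `a` and `b` for the single tasks, and the discount
`disc` on the pair. -/
structure RootType where
  (a b disc : ℝ)

/-- The additive root types. -/
@[simps]
def RootType.additive (a b : ℝ) : RootType := ⟨a, b, 0⟩

/-- The root types for which the first task is free on top of the second. -/
@[simps]
def RootType.coupled (a b : ℝ) : RootType := ⟨a, b, a⟩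

/-- The root types for which truthfulness is available: additive ones, and coupled ones whose first
task is small, both absolutely and compared to the second task. -/
def RootType.Admissible (ε A : ℝ) (t : RootType) : Prop :=
  0 ≤ t.a ∧ 0 ≤ t.b ∧ (t.disc = 0 ∨ t.disc = t.a ∧ t.a ≤ A ∧ t.a ≤ ε * t.b)

lemma RootType.Admissible.additive {ε A a b : ℝ} (ha : 0 ≤ a) (hb : 0 ≤ b) :
    (RootType.additive a b).Admissible ε A :=
  ⟨ha, hb, Or.inl rfl⟩

lemma RootType.Admissible.coupled {ε A b : ℝ} (hA : 0 ≤ A) (hb : 0 ≤ b) (hAb : A ≤ ε * b) :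
    (RootType.coupled A b).Admissible ε A :=
  ⟨hA, hb, Or.inr ⟨rfl, le_rfl, hAb⟩⟩

/-- The additive cost of a part of the pair; the two bits say which tasks belong to the part. -/
def pairCost (p : ℝ × ℝ) (B : Bool × Bool) : ℝ :=
  (if B.1 then p.1 else 0) + if B.2 then p.2 else 0

/-- The cost of a part of the pair for the root. -/
def RootType.cost (t : RootType) (B : Bool × Bool) : ℝ :=
  pairCost (t.a, t.b) B - if B.1 ∧ B.2 then t.disc else 0

@[simp] lemma RootType.cost_true_true (t : RootType) :
    t.cost (true, true) = t.a + t.b - t.disc := by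
  simp [cost, pairCost]

@[simp] lemma RootType.cost_true_false (t : RootType) : t.cost (true, false) = t.a := by
  simp [cost, pairCost]

@[simp] lemma RootType.cost_false_true (t : RootType) : t.cost (false, true) = t.b := by
  simp [cost, pairCost]

@[simp] lemma RootType.cost_false_false (t : RootType) : t.cost (false, false) = 0 := by
  simp [cost, pairCost]

/-- The cost of a task for the machine `z`: it is `r` for the root `k`, `x` for the leaf `i`, and at
least `h` for every other machine, unless that machine belongs to `σ` and has the task for free. -/
def taskCost {V : Type*} [DecidableEq V] (k i : V) (h r x : ℝ) (σ : Finset V) (z : V) : ℝ :=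
  if z = k then r else if z = i then x else if z ∈ σ then 0 else h

/-- What a mechanism does with two tasks when everything is fixed except the type of the root on
these tasks, the costs of one leaf for them, and the set of the other leaves that have the second
task for free: the machines that receive the tasks, and the payment to the root net of its cost for
the remaining tasks. -/
structure PairModel (V : Type*) where
  (holderA holderB : RootType → ℝ × ℝ → Finset V → V)
  pay : RootType → ℝ × ℝ → Finset V → ℝ

/-- The part of the pair that the machine `z` receives. -/
def PairModel.bundle {V : Type*} [DecidableEq V] (G : PairModel V) (z : V) (t : RootType)
    (p : ℝ × ℝ) (σ : Finset V) : Bool × Bool :=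
  (decide (G.holderA t p σ = z), decide (G.holderB t p σ = z))

/-- The utility of the root `k` of type `t` that reports `t'`. -/
def PairModel.utility {V : Type*} [DecidableEq V] (G : PairModel V) (k : V) (t t' : RootType)
    (p : ℝ × ℝ) (σ : Finset V) : ℝ :=
  G.pay t' p σ - t.cost (G.bundle k t' p σ)

/-- The value of the first task for a root that receives the second one. -/
def PairModel.gain {V : Type*} (G : PairModel V) (κ h : ℝ) (p : ℝ × ℝ) : ℝ :=
  G.pay (.additive κ κ) p ∅ - G.pay (.additive h κ) p ∅

/-- The value of the second task for a root that does not receive the first one. -/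
def PairModel.rent {V : Type*} (G : PairModel V) (κ h : ℝ) (p : ℝ × ℝ) : ℝ :=
  G.pay (.additive h κ) p ∅ - G.pay (.additive h h) p ∅

/-- The magnitudes of the construction, for approximation ratio `c`, root cost at most `C` outside
the pair, and leaf cost at most `x₀` for the first task: the root cost `A` for the first task is too
large when another machine has both tasks cheaply, the leaf costs in `[Y, Y']` for the second task
are too large when the root has it cheaply, and the cost `h` is too large in all cases. -/
structure Scales (c C x₀ : ℝ) where
  (A Y Y' h : ℝ)
  one_le_c : 1 ≤ c
  nonneg_C : 0 ≤ C
  nonneg_x₀ : 0 ≤ x₀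
  lt_A : c * (C + x₀ + 1) + 1 < A
  lt_Y : c * (C + x₀ + 1) < Y
  Y_le_Y' : Y ≤ Y'
  lt_h : c * (C + x₀ + 1 + Y') < h

variable {V : Type*} [DecidableEq V] {c C x₀ ε κ : ℝ}

namespace Scales

/-- The leaf costs that occur in the construction. -/
def box (P : Scales c C x₀) : Set (ℝ × ℝ) :=
  Set.Icc 0 x₀ ×ˢ Set.Icc P.Y P.Y'

lemma mul_le_mul (P : Scales c C x₀) {u v : ℝ} (huv : u ≤ v) : c * u ≤ c * v :=
  mul_le_mul_of_nonneg_left huv (zero_le_one.trans P.one_le_c)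

lemma nonneg_mul (P : Scales c C x₀) {u : ℝ} (hu : 0 ≤ u) : 0 ≤ c * u :=
  mul_nonneg (zero_le_one.trans P.one_le_c) hu

lemma one_lt_A (P : Scales c C x₀) : 1 < P.A := by
  linarith [P.lt_A, P.nonneg_mul (u := C + x₀ + 1) (by linarith [P.nonneg_C, P.nonneg_x₀])]

lemma one_lt_Y (P : Scales c C x₀) : 1 < P.Y := by
  nlinarith [P.lt_Y, P.one_le_c, P.nonneg_C, P.nonneg_x₀]

lemma Y_pos (P : Scales c C x₀) : 0 < P.Y :=
  zero_lt_one.trans P.one_lt_Y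

lemma lt_h' (P : Scales c C x₀) : c * (C + x₀ + 1) < P.h :=
  (P.mul_le_mul (by linarith [P.Y_pos, P.Y_le_Y'])).trans_lt P.lt_h

lemma one_lt_h (P : Scales c C x₀) : 1 < P.h := by
  nlinarith [P.lt_h', P.one_le_c, P.nonneg_C, P.nonneg_x₀]

lemma h_pos (P : Scales c C x₀) : 0 < P.h :=
  zero_lt_one.trans P.one_lt_h

lemma nonneg_of_mem_box (P : Scales c C x₀) {p : ℝ × ℝ} (hp : p ∈ P.box) : 0 ≤ p :=
  ⟨hp.1.1, P.Y_pos.le.trans hp.2.1⟩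

end Scales

/-- The properties that a pair model inherits from a mechanism: truthfulness for the root, weak
monotonicity (a consequence of truthfulness) for the leaf, and approximation on additive types.
There, every `z` gives a competing allocation: the first task for the leaf, the second one for `z`
and the remaining tasks for the root. -/
structure PairModel.Sound (G : PairModel V) (P : Scales c C x₀) (ε : ℝ) (k i : V) : Prop where
  ne : i ≠ k
  root : ∀ {t t' p σ}, t.Admissible ε P.A → t'.Admissible ε P.A → 0 ≤ p →
    G.utility k t t' p σ ≤ G.utility k t t p σ
  leaf : ∀ {t p p' σ}, t.Admissible ε P.A → 0 ≤ p → 0 ≤ p' →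
    pairCost p (G.bundle i t p σ) + pairCost p' (G.bundle i t p' σ) ≤
      pairCost p (G.bundle i t p' σ) + pairCost p' (G.bundle i t p σ)
  approx : ∀ {a b p σ}, 0 ≤ a → 0 ≤ b → 0 ≤ p → ∀ z,
    taskCost k i P.h a p.1 ∅ (G.holderA (.additive a b) p σ) ≤
        c * (C + p.1 + taskCost k i P.h b p.2 σ z) ∧
      taskCost k i P.h b p.2 σ (G.holderB (.additive a b) p σ) ≤
        c * (C + p.1 + taskCost k i P.h b p.2 σ z)

section TaskCost

variable {k i z : V} {h r x : ℝ}

lemma taskCost_root {σ : Finset V} : taskCost k i h r x σ k = r := if_pos rfl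

lemma taskCost_leaf (hik : i ≠ k) {σ : Finset V} : taskCost k i h r x σ i = x := by
  simp [taskCost, hik]

lemma eq_root_or_eq_leaf_of_taskCost_lt (hz : taskCost k i h r x ∅ z < h) : z = k ∨ z = i := by
  by_contra! hne
  simp [taskCost, hne] at hz

lemma eq_root_of_taskCost_lt (hz : taskCost k i h r x ∅ z < h) (hx : taskCost k i h r x ∅ z < x) :
    z = k := by
  rcases eq_root_or_eq_leaf_of_taskCost_lt hz with rfl | rfl
  · rfl
  · by_contra hik
    exact (taskCost_leaf hik).not_lt hx

lemma eq_leaf_of_taskCost_lt (hz : taskCost k i h r x ∅ z < h) (hr : taskCost k i h r x ∅ z < r) :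
    z = i :=
  (eq_root_or_eq_leaf_of_taskCost_lt hz).resolve_left fun hk => (hk ▸ hr).ne taskCost_root

end TaskCost

namespace PairModel.Sound

variable {G : PairModel V} {P : Scales c C x₀} {k i : V} {p p' : ℝ × ℝ}

lemma approx_root (S : G.Sound P ε k i) {a b u : ℝ} (ha : 0 ≤ a) (hb : 0 ≤ b) (hp : 0 ≤ p)
    (hu : C + p.1 + b ≤ u) :
    taskCost k i P.h a p.1 ∅ (G.holderA (.additive a b) p ∅) ≤ c * u ∧
      taskCost k i P.h b p.2 ∅ (G.holderB (.additive a b) p ∅) ≤ c * u := by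
  have hk := S.approx ha hb hp (σ := ∅) k
  rw [taskCost_root] at hk
  exact hk.imp (·.trans (P.mul_le_mul hu)) (·.trans (P.mul_le_mul hu))

lemma approx_leaf (S : G.Sound P ε k i) {a b u : ℝ} (ha : 0 ≤ a) (hb : 0 ≤ b) (hp : 0 ≤ p)
    (hu : C + p.1 + p.2 ≤ u) :
    taskCost k i P.h a p.1 ∅ (G.holderA (.additive a b) p ∅) ≤ c * u ∧
      taskCost k i P.h b p.2 ∅ (G.holderB (.additive a b) p ∅) ≤ c * u := by
  have hi := S.approx ha hb hp (σ := ∅) i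
  rw [taskCost_leaf S.ne] at hi
  exact hi.imp (·.trans (P.mul_le_mul hu)) (·.trans (P.mul_le_mul hu))

lemma holder_of_light (S : G.Sound P ε k i) (hκ : κ ∈ Set.Ioc 0 1) {a : ℝ} (ha : 0 ≤ a)
    (hp : p ∈ P.box) :
    G.holderB (.additive a κ) p ∅ = k ∧
      (G.holderA (.additive a κ) p ∅ = k ∨ G.holderA (.additive a κ) p ∅ = i) := by
  obtain ⟨hA, hB⟩ := S.approx_root ha hκ.1.le (P.nonneg_of_mem_box hp)
    (add_le_add (add_le_add_right hp.1.2 C) hκ.2)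
  exact ⟨eq_root_of_taskCost_lt (hB.trans_lt P.lt_h') (hB.trans_lt (P.lt_Y.trans_le hp.2.1)),
    eq_root_or_eq_leaf_of_taskCost_lt (hA.trans_lt P.lt_h')⟩

lemma holder_of_heavy (S : G.Sound P ε k i) {b : ℝ} (hb : 0 ≤ b) (hp : p ∈ P.box) :
    G.holderA (.additive P.h b) p ∅ = i ∧
      (G.holderB (.additive P.h b) p ∅ = k ∨ G.holderB (.additive P.h b) p ∅ = i) := by
  obtain ⟨hA, hB⟩ := S.approx_leaf P.h_pos.le hb (P.nonneg_of_mem_box hp)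
    (u := C + x₀ + 1 + P.Y') (by linarith [hp.1.2, hp.2.2])
  exact ⟨eq_leaf_of_taskCost_lt (hA.trans_lt P.lt_h) (hA.trans_lt P.lt_h),
    eq_root_or_eq_leaf_of_taskCost_lt (hB.trans_lt P.lt_h)⟩

/-- Comparison with a leaf of costs `(x₀ + 1, 0)`, which certainly receives both tasks: by weak
monotonicity the leaf does not give up the cheaper first task while it keeps the second one. -/
lemma bundle_of_heavy (S : G.Sound P ε k i) {a : ℝ} (ha : c * (C + x₀ + 1) < a)
    (hp : p ∈ P.box) : G.bundle k (.additive a P.h) p ∅ = (false, false) := by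
  have hp₀ := P.nonneg_of_mem_box hp
  have ha₀ : 0 ≤ a := (P.nonneg_mul (by linarith [P.nonneg_C, P.nonneg_x₀])).trans ha.le
  have hq₀ : (0 : ℝ × ℝ) ≤ (x₀ + 1, 0) := ⟨add_nonneg P.nonneg_x₀ zero_le_one, le_rfl⟩
  have hB := (S.approx_leaf ha₀ P.h_pos.le hp₀ (u := C + x₀ + 1 + P.Y')
    (by linarith [hp.1.2, hp.2.2])).2.trans_lt P.lt_h
  obtain ⟨hA', hB'⟩ := S.approx_leaf ha₀ P.h_pos.le hq₀ (u := C + x₀ + 1) (by simp [add_assoc])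
  have hBi := eq_leaf_of_taskCost_lt hB hB
  have hAi' := eq_leaf_of_taskCost_lt (hA'.trans_lt P.lt_h') (hA'.trans_lt ha)
  have hBi' := eq_leaf_of_taskCost_lt (hB'.trans_lt P.lt_h') (hB'.trans_lt P.lt_h')
  have hAk : G.holderA (.additive a P.h) p ∅ ≠ k := fun hk => by
    have hleaf := S.leaf (.additive ha₀ P.h_pos.le) hp₀ hq₀ (σ := ∅)
    simp only [pairCost, bundle, hBi, hAi', hBi', hk, S.ne.symm, decide_true, decide_false,
      Bool.false_eq_true, if_true, if_false] at hleaf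
    linarith [hp.1.2]
  simp [bundle, hAk, hBi, S.ne]

lemma bundle_ref (S : G.Sound P ε k i) (hκ : κ ∈ Set.Ioc 0 1) (hp : p ∈ P.box) :
    G.bundle k (.additive P.h κ) p ∅ = (false, true) := by
  simp [bundle, (S.holder_of_light hκ P.h_pos.le hp).1, (S.holder_of_heavy hκ.1.le hp).1, S.ne]

lemma le_gain (S : G.Sound P ε k i) (hκ : κ ∈ Set.Ioc 0 1) {a : ℝ} (ha : 0 ≤ a)
    (hp : p ∈ P.box) (hboth : G.bundle k (.additive κ κ) p ∅ = (true, true))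
    (hak : G.holderA (.additive a κ) p ∅ = k) : a ≤ G.gain κ P.h p := by
  have hp₀ := P.nonneg_of_mem_box hp
  have hbundle : G.bundle k (.additive a κ) p ∅ = (true, true) := by
    simp [bundle, hak, (S.holder_of_light hκ ha hp).1]
  have h₁ := S.root (σ := ∅) (.additive ha hκ.1.le) (.additive P.h_pos.le hκ.1.le) hp₀
  have h₂ := S.root (σ := ∅) (.additive hκ.1.le hκ.1.le) (.additive ha hκ.1.le) hp₀
  simp only [utility, hbundle, hboth, S.bundle_ref hκ hp, RootType.cost_true_true,
    RootType.cost_false_true, RootType.additive_a, RootType.additive_b,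
    RootType.additive_disc] at h₁ h₂
  rw [gain]
  linarith

lemma gain_le (S : G.Sound P ε k i) (hκ : κ ∈ Set.Ioc 0 1) {a : ℝ} (ha : 0 ≤ a)
    (hp : p ∈ P.box) (hboth : G.bundle k (.additive κ κ) p ∅ = (true, true))
    (hak : G.holderA (.additive a κ) p ∅ ≠ k) : G.gain κ P.h p ≤ a := by
  have hp₀ := P.nonneg_of_mem_box hp
  have hbundle : G.bundle k (.additive a κ) p ∅ = (false, true) := by
    simp [bundle, hak, (S.holder_of_light hκ ha hp).1]
  have h₁ := S.root (σ := ∅) (.additive ha hκ.1.le) (.additive hκ.1.le hκ.1.le) hp₀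
  have h₂ := S.root (σ := ∅) (.additive P.h_pos.le hκ.1.le) (.additive ha hκ.1.le) hp₀
  simp only [utility, hbundle, hboth, S.bundle_ref hκ hp, RootType.cost_true_true,
    RootType.cost_false_true, RootType.additive_a, RootType.additive_b,
    RootType.additive_disc] at h₁ h₂
  rw [gain]
  linarith

lemma gain_pos (S : G.Sound P ε k i) (hκ : κ ∈ Set.Ioc 0 1) (hp : p ∈ P.box)
    (hboth : G.bundle k (.additive κ κ) p ∅ = (true, true)) : 0 < G.gain κ P.h p :=
  hκ.1.trans_le (S.le_gain hκ hκ.1.le hp hboth (of_decide_eq_true (congrArg Prod.fst hboth)))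

lemma le_rent_of_holderB_eq (S : G.Sound P ε k i) (hκ : κ ∈ Set.Ioc 0 1) {b : ℝ} (hb : 0 ≤ b)
    (hp : p ∈ P.box) (hbk : G.holderB (.additive P.h b) p ∅ = k) : b ≤ G.rent κ P.h p := by
  have hp₀ := P.nonneg_of_mem_box hp
  have hbundle : G.bundle k (.additive P.h b) p ∅ = (false, true) := by
    simp [bundle, hbk, (S.holder_of_heavy hb hp).1, S.ne]
  have h₁ := S.root (σ := ∅) (.additive P.h_pos.le hb) (.additive P.h_pos.le P.h_pos.le) hp₀
  have h₂ := S.root (σ := ∅) (.additive P.h_pos.le hκ.1.le) (.additive P.h_pos.le hb) hp₀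
  simp only [utility, hbundle, S.bundle_of_heavy P.lt_h' hp, S.bundle_ref hκ hp,
    RootType.cost_false_false, RootType.cost_false_true, RootType.additive_b] at h₁ h₂
  rw [rent]
  linarith

lemma rent_le_of_holderB_ne (S : G.Sound P ε k i) (hκ : κ ∈ Set.Ioc 0 1) {b : ℝ} (hb : 0 ≤ b)
    (hp : p ∈ P.box) (hbk : G.holderB (.additive P.h b) p ∅ ≠ k) : G.rent κ P.h p ≤ b := by
  have hp₀ := P.nonneg_of_mem_box hp
  have hbundle : G.bundle k (.additive P.h b) p ∅ = (false, false) := by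
    simp [bundle, hbk, (S.holder_of_heavy hb hp).1, S.ne]
  have h₁ := S.root (σ := ∅) (.additive P.h_pos.le hb) (.additive P.h_pos.le hκ.1.le) hp₀
  have h₂ := S.root (σ := ∅) (.additive P.h_pos.le P.h_pos.le) (.additive P.h_pos.le hb) hp₀
  simp only [utility, hbundle, S.bundle_of_heavy P.lt_h' hp, S.bundle_ref hκ hp,
    RootType.cost_false_false, RootType.cost_false_true, RootType.additive_b] at h₁ h₂
  rw [rent]
  linarith

lemma gain_mono (S : G.Sound P ε k i) (hκ : κ ∈ Set.Ioc 0 1) (hp : p ∈ P.box) (hp' : p' ∈ P.box)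
    (hlt : p.1 < p'.1) (hboth : G.bundle k (.additive κ κ) p ∅ = (true, true))
    (hboth' : G.bundle k (.additive κ κ) p' ∅ = (true, true)) :
    G.gain κ P.h p ≤ G.gain κ P.h p' := by
  by_contra! hgain
  obtain ⟨a, ha', ha⟩ := exists_between hgain
  have ha₀ : 0 ≤ a := ((S.gain_pos hκ hp' hboth').trans ha').le
  have hA : G.holderA (.additive a κ) p ∅ = k :=
    by_contra fun h => (S.gain_le hκ ha₀ hp hboth h).not_gt ha
  have hA' : G.holderA (.additive a κ) p' ∅ = i := (S.holder_of_light hκ ha₀ hp').2.resolve_left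
    fun h => (S.le_gain hκ ha₀ hp' hboth' h).not_gt ha'
  have hleaf := S.leaf (t := .additive a κ) (σ := ∅) (.additive ha₀ hκ.1.le)
    (P.nonneg_of_mem_box hp) (P.nonneg_of_mem_box hp')
  simp only [pairCost, bundle, hA, hA', (S.holder_of_light hκ ha₀ hp).1,
    (S.holder_of_light hκ ha₀ hp').1, S.ne.symm, decide_true, decide_false, Bool.false_eq_true,
    if_true, if_false] at hleaf
  linarith

lemma le_rent (S : G.Sound P ε k i) (hκ : κ ∈ Set.Ioc 0 1) {b : ℝ} (hb : 0 ≤ b) (hp : p ∈ P.box)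
    (hlt : c * (C + x₀ + b) < p.2) : b ≤ G.rent κ P.h p := by
  refine S.le_rent_of_holderB_eq hκ hb hp ((S.holder_of_heavy hb hp).2.resolve_right fun hi => ?_)
  have hB := (S.approx_root P.h_pos.le hb (P.nonneg_of_mem_box hp)
    (u := C + x₀ + b) (by linarith [hp.1.2])).2
  rw [hi, taskCost_leaf S.ne] at hB
  exact hlt.not_ge hB

lemma rent_le (S : G.Sound P ε k i) (hκ : κ ∈ Set.Ioc 0 1) (hp : p ∈ P.box) :
    G.rent κ P.h p ≤ c * (C + x₀ + p.2) + 1 := by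
  have hp₀ := P.nonneg_of_mem_box hp
  have hb : 0 ≤ c * (C + x₀ + p.2) + 1 := add_nonneg
    (P.nonneg_mul (add_nonneg (add_nonneg P.nonneg_C P.nonneg_x₀) hp₀.2)) zero_le_one
  refine S.rent_le_of_holderB_ne hκ hb hp fun hk => ?_
  have hB := (S.approx_leaf P.h_pos.le hb hp₀ (u := C + x₀ + p.2) (by linarith [hp.1.2])).2
  rw [hk, taskCost_root] at hB
  linarith

lemma rent_mono (S : G.Sound P ε k i) (hκ : κ ∈ Set.Ioc 0 1) (hp : p ∈ P.box) (hp' : p' ∈ P.box)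
    (hlt : p.2 < p'.2) : G.rent κ P.h p ≤ G.rent κ P.h p' := by
  by_contra! hrent
  obtain ⟨b, hb', hb⟩ := exists_between hrent
  have hrent₀ : 0 ≤ G.rent κ P.h p' := S.le_rent hκ le_rfl hp'
    (((P.mul_le_mul (by linarith)).trans_lt P.lt_Y).trans_le hp'.2.1)
  have hb₀ : 0 ≤ b := hrent₀.trans hb'.le
  have hB : G.holderB (.additive P.h b) p ∅ = k :=
    by_contra fun h => (S.rent_le_of_holderB_ne hκ hb₀ hp h).not_gt hb
  have hB' : G.holderB (.additive P.h b) p' ∅ = i := (S.holder_of_heavy hb₀ hp').2.resolve_left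
    fun h => (S.le_rent_of_holderB_eq hκ hb₀ hp' h).not_gt hb'
  have hleaf := S.leaf (t := .additive P.h b) (σ := ∅) (.additive P.h_pos.le hb₀)
    (P.nonneg_of_mem_box hp) (P.nonneg_of_mem_box hp')
  simp only [pairCost, bundle, hB, hB', (S.holder_of_heavy hb₀ hp).1,
    (S.holder_of_heavy hb₀ hp').1, S.ne.symm, decide_true, decide_false, Bool.false_eq_true,
    if_true, if_false] at hleaf
  linarith

/-- The root cannot want the first task without the second: a root for which the second task is out
of reach would imitate it. It cannot want the second without the first: the first one is free. -/
lemma bundle_coupled (S : G.Sound P ε k i) (hκ : κ ∈ Set.Ioc 0 1) {β : ℝ} (hβ : 0 ≤ β)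
    (hAβ : P.A ≤ ε * β) (hp : p ∈ P.box)
    (hboth : G.bundle k (.additive κ κ) p ∅ = (true, true)) :
    G.bundle k (.coupled P.A β) p ∅ = (true, true) ∨
      G.bundle k (.coupled P.A β) p ∅ = (false, false) := by
  have hA := P.one_lt_A
  have hp₀ := P.nonneg_of_mem_box hp
  have tc := RootType.Admissible.coupled (by linarith) hβ hAβ
  have tκ : (RootType.additive κ κ).Admissible ε P.A := .additive hκ.1.le hκ.1.le
  have ta : (RootType.additive (P.A - 1) P.h).Admissible ε P.A :=
    .additive (by linarith) P.h_pos.le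
  have hκc := S.root (σ := ∅) tκ tc hp₀
  have hcκ := S.root (σ := ∅) tc tκ hp₀
  have hac := S.root (σ := ∅) ta tc hp₀
  have hca := S.root (σ := ∅) tc ta hp₀
  have hnone := S.bundle_of_heavy (a := P.A - 1) (by linarith [P.lt_A]) hp
  simp only [utility, hboth, hnone] at hκc hcκ hac hca
  rcases hbundle : G.bundle k (.coupled P.A β) p ∅ with ⟨_ | _, _ | _⟩
  · exact Or.inr rfl
  · simp only [hbundle, RootType.cost_true_true, RootType.cost_false_true, RootType.additive_a,
      RootType.additive_b, RootType.additive_disc, RootType.coupled_a, RootType.coupled_b,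
      RootType.coupled_disc] at hκc hcκ
    linarith [hκ.1]
  · simp only [hbundle, RootType.cost_true_false, RootType.cost_false_false, RootType.additive_a,
      RootType.coupled_a] at hac hca
    linarith
  · exact Or.inl rfl

lemma lt_gain_add_rent_iff (S : G.Sound P ε k i) (hκ : κ ∈ Set.Ioc 0 1) {β : ℝ} (hβ : 0 ≤ β)
    (hAβ : P.A ≤ ε * β) (hp : p ∈ P.box)
    (hboth : G.bundle k (.additive κ κ) p ∅ = (true, true))
    (hne : G.gain κ P.h p + G.rent κ P.h p ≠ β) :
    G.holderA (.coupled P.A β) p ∅ = k ↔ β < G.gain κ P.h p + G.rent κ P.h p := by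
  have hp₀ := P.nonneg_of_mem_box hp
  have tc := RootType.Admissible.coupled (by linarith [P.one_lt_A]) hβ hAβ
  have tκ : (RootType.additive κ κ).Admissible ε P.A := .additive hκ.1.le hκ.1.le
  have th : (RootType.additive P.h P.h).Admissible ε P.A := .additive P.h_pos.le P.h_pos.le
  have hnone := S.bundle_of_heavy P.lt_h' hp
  rw [gain, rent, sub_add_sub_cancel] at hne ⊢
  rcases S.bundle_coupled hκ hβ hAβ hp hboth with hbundle | hbundle
  · have hch := S.root (σ := ∅) tc th hp₀
    have hκc := S.root (σ := ∅) tκ tc hp₀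
    simp only [utility, hboth, hnone, hbundle, RootType.cost_true_true, RootType.cost_false_false,
      RootType.coupled_a, RootType.coupled_b, RootType.coupled_disc] at hch hκc
    exact iff_of_true (of_decide_eq_true (congrArg Prod.fst hbundle))
      (hne.symm.lt_of_le (by linarith))
  · have hcκ := S.root (σ := ∅) tc tκ hp₀
    have hhc := S.root (σ := ∅) th tc hp₀
    simp only [utility, hboth, hnone, hbundle, RootType.cost_true_true, RootType.cost_false_false,
      RootType.coupled_a, RootType.coupled_b, RootType.coupled_disc] at hcκ hhc
    exact iff_of_false (of_decide_eq_false (congrArg Prod.fst hbundle)) (by linarith)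

/-- Some other machine has the second task for free, hence an additive root of costs `A - 1` and
`A - 1` receives nothing; it would imitate a coupled root that receives something. -/
lemma holderA_coupled_ne (S : G.Sound P ε k i) {β : ℝ} (hAβ : P.A ≤ ε * β) (hβ : 2 * P.A < β)
    (hp : p ∈ P.box) {σ : Finset V} {z : V} (hz : z ∈ σ) (hzk : z ≠ k) (hzi : z ≠ i) :
    G.holderA (.coupled P.A β) p σ ≠ k := by
  have hA := P.one_lt_A
  have hp₀ := P.nonneg_of_mem_box hp
  have tc := RootType.Admissible.coupled (by linarith) (by linarith) hAβ
  have ta : (RootType.additive (P.A - 1) (P.A - 1)).Admissible ε P.A :=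
    .additive (by linarith) (by linarith)
  have hcheap : c * (C + p.1) < P.A - 1 :=
    (P.mul_le_mul (by linarith [hp.1.2] : C + p.1 ≤ C + x₀ + 1)).trans_lt (by linarith [P.lt_A])
  have happrox := S.approx (a := P.A - 1) (b := P.A - 1) (σ := σ) ta.1 ta.1 hp₀ z
  have hz₀ : taskCost k i P.h (P.A - 1) p.2 σ z = 0 := by simp [taskCost, hz, hzk, hzi]
  rw [hz₀, add_zero] at happrox
  have hnone : G.bundle k (.additive (P.A - 1) (P.A - 1)) p σ = (false, false) := by
    simp only [bundle, Prod.mk.injEq, decide_eq_false_iff_not]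
    refine ⟨fun h => ?_, fun h => ?_⟩ <;> rw [h, taskCost_root] at happrox
    · exact hcheap.not_ge happrox.1
    · exact hcheap.not_ge happrox.2
  intro hak
  have hca := S.root (σ := σ) tc ta hp₀
  have hac := S.root (σ := σ) ta tc hp₀
  have hbundle : G.bundle k (.coupled P.A β) p σ =
      (true, decide (G.holderB (.coupled P.A β) p σ = k)) := by simp [bundle, hak]
  cases hbk : decide (G.holderB (.coupled P.A β) p σ = k) <;>
    simp only [utility, hnone, hbundle, hbk, RootType.cost_true_true, RootType.cost_true_false,
      RootType.cost_false_false, RootType.additive_a, RootType.additive_b, RootType.additive_disc,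
      RootType.coupled_a, RootType.coupled_b, RootType.coupled_disc] at hca hac <;>
    linarith

end PairModel.Sound

end PairModel

/-! ### Crossings on a grid -/

section Grid

/-- The possible kinds of flips: the machines with a free second task, and the parts of the pair
that the leaf receives before and after the flip. -/
abbrev FlipKind (V : Type*) : Type _ := Finset V × (Bool × Bool) × (Bool × Bool)

/-- The leaf `i` gains or loses the first task when its costs change from `p` to `p'`. -/
def PairModel.IsFlip {V : Type*} [DecidableEq V] (G : PairModel V) (i : V) (t : RootType)
    (p p' : ℝ × ℝ) (f : FlipKind V) : Prop :=
  G.bundle i t p f.1 = f.2.1 ∧ G.bundle i t p' f.1 = f.2.2 ∧ f.2.1.1 ≠ f.2.2.1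

/-- The mesh of leaf costs on which the mechanism is tested, and its constants: the mesh width `w`;
`M` values of the first cost; `Q` blocks of `d` values of the second cost, in one of which the rent
increases by more than `Γ + s`; a lower bound `b` for the root costs of the second task; `K` is the
number of kinds of flips to be distinguished. -/
structure Grid (K : ℕ) (ε c C Γ x₀ : ℝ) extends Scales c C x₀ where
  (w s b : ℝ)
  (M d Q : ℕ)
  nonneg_Γ : 0 ≤ Γ
  w_pos : 0 < w
  s_pos : 0 < s
  M_mul_w_lt : M * w < x₀
  le_M : d + 2 + 6 * K + 1 ≤ M
  le_d_mul_w : c * (Γ + 2 * s) ≤ d * w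
  lt_Q_mul_s : c * (C + x₀ + Y + w) + 1 + C + x₀ < Q * s
  le_Y' : Y + (Q * d + 2) * w ≤ Y'
  two_mul_A_lt : 2 * A < b
  mul_lt_Y : c * (C + x₀ + b) < Y
  A_le_mul : ∀ β, b ≤ β → A ≤ ε * β

variable {V : Type*} [DecidableEq V] {c C x₀ ε κ Γ : ℝ} {k i : V} {K : ℕ}

namespace Grid

/-- The point of the mesh in column `j` and row `l`. -/
def point (g : Grid K ε c C Γ x₀) (j l : ℕ) : ℝ × ℝ := ((j + 1) * g.w, g.Y + l * g.w)

/-- The leaf costs with the largest first cost of the construction. -/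
def corner (g : Grid K ε c C Γ x₀) : ℝ × ℝ := (x₀, g.Y)

/-- The points of the mesh. -/
noncomputable def points (g : Grid K ε c C Γ x₀) : Finset (ℝ × ℝ) :=
  (range g.M ×ˢ range (g.Q * g.d + 3)).image fun q => g.point q.1 q.2

/-- Finite sets of root costs for the second task that contain, in every interval of length `s`, an
element that avoids any given set of at most as many numbers as there are mesh points. -/
def IsNet (g : Grid K ε c C Γ x₀) (T : Finset ℝ) : Prop :=
  (∀ β ∈ T, g.b ≤ β) ∧ ∀ l ∈ Set.Icc g.b (c * (C + x₀ + g.Y') + 1 + Γ), ∀ V : Finset ℝ,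
    #V ≤ #g.points → ∃ β ∈ T, β ∈ Set.Ioo l (l + g.s) ∧ β ∉ V

variable (g : Grid K ε c C Γ x₀) {j l : ℕ}

lemma point_add_one (j l : ℕ) : g.point j (l + 1) = g.point j l + (0, g.w) := by
  simp only [point, Prod.mk_add_mk, add_zero, Prod.mk.injEq, true_and]
  push_cast
  ring

lemma point_mem_points (hj : j < g.M) (hl : l ≤ g.Q * g.d + 2) : g.point j l ∈ g.points :=
  mem_image_of_mem (fun q : ℕ × ℕ => g.point q.1 q.2)
    (mk_mem_product (mem_range.2 hj) (mem_range.2 (Nat.lt_succ_of_le hl)))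

lemma M_pos : 0 < g.M := by have := g.le_M; omega

lemma fst_lt_of_mem_points {p : ℝ × ℝ} (hp : p ∈ g.points) : p.1 < x₀ := by
  simp only [points, mem_image, mem_product, mem_range] at hp
  obtain ⟨⟨j, l⟩, ⟨hj, -⟩, rfl⟩ := hp
  have hjM : (j + 1 : ℝ) ≤ g.M := mod_cast hj
  exact (mul_le_mul_of_nonneg_right hjM g.w_pos.le).trans_lt g.M_mul_w_lt

lemma mem_box_of_mem_points {p : ℝ × ℝ} (hp : p ∈ g.points) : p ∈ g.toScales.box := by
  have hlt := g.fst_lt_of_mem_points hp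
  simp only [points, mem_image, mem_product, mem_range] at hp
  obtain ⟨⟨j, l⟩, ⟨-, hl⟩, rfl⟩ := hp
  have hw := g.w_pos
  have hlQ : (l : ℝ) ≤ g.Q * g.d + 2 := mod_cast Nat.lt_succ_iff.1 hl
  refine ⟨⟨?_, hlt.le⟩, ?_, ?_⟩ <;> simp only [point]
  · positivity
  · exact le_add_of_nonneg_right (by positivity)
  · exact (add_le_add_right (mul_le_mul_of_nonneg_right hlQ hw.le) g.Y).trans g.le_Y'

lemma corner_mem_box : g.corner ∈ g.toScales.box :=
  ⟨⟨g.nonneg_x₀, le_rfl⟩, le_rfl, g.Y_le_Y'⟩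

lemma le_of_mem {p : ℝ × ℝ} (hp : p ∈ insert g.corner g.points) : (g.w, g.Y) ≤ p := by
  rcases mem_insert.1 hp with rfl | hp
  · have hM : (1 : ℝ) ≤ g.M := mod_cast g.M_pos
    exact ⟨(le_mul_of_one_le_left g.w_pos.le hM).trans g.M_mul_w_lt.le, le_rfl⟩
  · simp only [points, mem_image, mem_product, mem_range] at hp
    obtain ⟨⟨j, l⟩, -, rfl⟩ := hp
    have hw := g.w_pos
    exact ⟨le_mul_of_one_le_left hw.le (le_add_of_nonneg_left j.cast_nonneg),
      le_add_of_nonneg_right (by positivity)⟩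

lemma nonneg_of_mem {p : ℝ × ℝ} (hp : p ∈ insert g.corner g.points) : 0 ≤ p :=
  (Prod.mk_le_mk.2 ⟨g.w_pos.le, g.Y_pos.le⟩).trans (g.le_of_mem hp)

lemma nonneg_b : 0 ≤ g.b := by linarith [g.two_mul_A_lt, g.one_lt_A]

lemma abs_le_one_of_abs_mul_le {z : ℤ} (hz : |z * g.w| ≤ g.w) : |z| ≤ 1 := by
  rw [abs_mul, abs_of_pos g.w_pos] at hz
  have hz' : |(z : ℝ)| ≤ 1 := le_of_mul_le_mul_right (hz.trans_eq (one_mul _).symm) g.w_pos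
  exact_mod_cast hz'

lemma nonempty (K : ℕ) {ε c C Γ x₀ : ℝ} (hε : 0 < ε) (hc : 1 ≤ c) (hC : 0 ≤ C) (hΓ : 0 ≤ Γ)
    (hx : c * Γ < x₀) : Nonempty (Grid K ε c C Γ x₀) := by
  have hx₀ : 0 < x₀ := (mul_nonneg (by linarith) hΓ).trans_lt hx
  obtain ⟨w, hw, hwx⟩ : ∃ w > 0, w * (6 * K + 6) = x₀ - c * Γ :=
    ⟨(x₀ - c * Γ) / (6 * K + 6), div_pos (by linarith) (by positivity), by field_simp⟩
  obtain ⟨s, hs, hsw⟩ : ∃ s > 0, c * (2 * s) = w := ⟨w / (2 * c), by positivity, by field_simp⟩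
  obtain ⟨d, hd, hd'⟩ : ∃ d : ℕ, c * Γ + w ≤ d * w ∧ d * w < c * Γ + w + w :=
    ⟨⌈(c * Γ + w) / w⌉₊, (div_le_iff₀ hw).1 (Nat.le_ceil _), by
      have := Nat.ceil_lt_add_one (a := (c * Γ + w) / w) (by positivity)
      rwa [← sub_lt_iff_lt_add, lt_div_iff₀ hw, sub_mul, one_mul, sub_lt_iff_lt_add] at this⟩
  obtain ⟨A, hA⟩ : ∃ A, c * (C + x₀ + 1) + 1 < A := exists_gt _
  have hcC : 0 ≤ c * (C + x₀ + 1) := by positivity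
  obtain ⟨b, hb⟩ := exists_gt (max (2 * A) (A / ε))
  obtain ⟨hAb, hAεb⟩ := max_lt_iff.1 hb
  obtain ⟨Y, hY⟩ := exists_gt (c * (C + x₀ + b))
  obtain ⟨Q, hQ⟩ := exists_nat_gt ((c * (C + x₀ + Y + w) + 1 + C + x₀) / s)
  obtain ⟨h, hh⟩ := exists_gt (c * (C + x₀ + 1 + (Y + (Q * d + 2) * w)))
  exact ⟨{
    A, Y, h, w, s, b, d, Q
    Y' := Y + (Q * d + 2) * w
    M := d + 2 + 6 * K + 1
    one_le_c := hc
    nonneg_C := hC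
    nonneg_x₀ := hx₀.le
    lt_A := hA
    lt_Y := (mul_le_mul_of_nonneg_left (by linarith) (by linarith)).trans_lt hY
    Y_le_Y' := le_add_of_nonneg_right (by positivity)
    lt_h := hh
    nonneg_Γ := hΓ
    w_pos := hw
    s_pos := hs
    M_mul_w_lt := by push_cast; linarith
    le_M := le_rfl
    le_d_mul_w := by linarith
    lt_Q_mul_s := (div_lt_iff₀ hs).1 hQ
    le_Y' := le_rfl
    two_mul_A_lt := hAb
    mul_lt_Y := hY
    A_le_mul := fun β hβ => (div_le_iff₀' hε).1 (hAεb.le.trans hβ) }⟩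

lemma exists_isNet : ∃ T, g.IsNet T := by
  obtain ⟨T, hT⟩ :=
    exists_finset_mem_Ioo_notMem (c * (C + x₀ + g.Y') + 1 + Γ) #g.points g.s_pos
  refine ⟨T.filter (g.b ≤ ·), fun β hβ => (mem_filter.1 hβ).2, fun l hl V hV => ?_⟩
  obtain ⟨β, hβT, hβl, hβV⟩ := hT l ⟨g.nonneg_b.trans hl.1, hl.2⟩ V hV
  exact ⟨β, mem_filter.2 ⟨hβT, hl.1.trans hβl.1.le⟩, hβl, hβV⟩

end Grid

namespace PairModel.Sound

variable {G : PairModel V} {P : Scales c C x₀} {g : Grid K ε c C Γ x₀} {T : Finset ℝ}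

/-- Weak monotonicity, applied crosswise: the flips of one kind happen along a line of slope `±1`,
according to whether the leaf exchanges one task for the other or both tasks for none. -/
lemma abs_le_of_isFlip (S : G.Sound P ε k i) {t : RootType} (ht : t.Admissible ε P.A)
    {p p' : ℝ × ℝ} {w : ℝ} {f : FlipKind V} (hp : 0 ≤ p) (hp' : 0 ≤ p') (hw : 0 ≤ w)
    (hne : p.1 ≠ p'.1) (hf : G.IsFlip i t p (p + (0, w)) f)
    (hf' : G.IsFlip i t p' (p' + (0, w)) f) :
    |(p.1 + p.2) - (p'.1 + p'.2)| ≤ w ∨ |(p.1 - p.2) - (p'.1 - p'.2)| ≤ w := by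
  have hw₀ : (0 : ℝ × ℝ) ≤ (0, w) := ⟨le_rfl, hw⟩
  have hleaf := S.leaf (σ := f.1) ht hp (add_nonneg hp' hw₀)
  have hleaf' := S.leaf (σ := f.1) ht (add_nonneg hp hw₀) hp'
  obtain ⟨σ, ⟨_ | _, _ | _⟩, ⟨_ | _, _ | _⟩⟩ := f <;> obtain ⟨h₁, h₂, hflip⟩ := hf <;>
    first | exact absurd rfl hflip | skip
  all_goals
    simp only [h₁, h₂, hf'.1, hf'.2.1, pairCost, Prod.fst_add, Prod.snd_add, Bool.false_eq_true,
      if_true, if_false] at hleaf hleaf'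
    first
    | exact absurd (by linarith) hne
    | exact Or.inl (abs_le.2 ⟨by linarith, by linarith⟩)
    | exact Or.inr (abs_le.2 ⟨by linarith, by linarith⟩)

lemma exists_isFlip [Fintype V] (S : G.Sound P ε k i) {β : ℝ} (hAβ : P.A ≤ ε * β)
    (hβ : 2 * P.A < β) {p p' : ℝ × ℝ} (hp : p ∈ P.box) (hp' : p' ∈ P.box)
    (htoggle : ToggleInvariant {k, i}ᶜ (G.holderA (.coupled P.A β) p))
    (htoggle' : ToggleInvariant {k, i}ᶜ (G.holderA (.coupled P.A β) p'))
    (hne : G.holderA (.coupled P.A β) p ∅ ≠ k) (heq : G.holderA (.coupled P.A β) p' ∅ = k) :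
    ∃ f, G.IsFlip i (.coupled P.A β) p p' f := by
  have hfree {q : ℝ × ℝ} (hq : q ∈ P.box) : ∀ σ ⊆ {k, i}ᶜ, σ.Nonempty →
      G.holderA (.coupled P.A β) q σ ≠ k := fun σ hσ ⟨z, hz⟩ => by
    have hzki := hσ hz
    simp only [mem_compl, mem_insert, mem_singleton, not_or] at hzki
    exact S.holderA_coupled_ne hAβ hβ hq hz hzki.1 hzki.2
  obtain ⟨σ, hσ⟩ := htoggle.exists_eq_iff_ne S.ne htoggle'
    (fun σ hσ => σ.eq_empty_or_nonempty.elim (fun h => h ▸ hne) (hfree hp σ hσ)) (hfree hp') heq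
  exact ⟨(σ, G.bundle i (.coupled P.A β) p σ, G.bundle i (.coupled P.A β) p' σ), rfl, rfl,
    fun h => hσ (decide_eq_decide.1 h)⟩

/-- On average the rent grows at least as fast as `1 / c`. -/
lemma exists_rent_add_lt (S : G.Sound g.toScales ε k i) (hκ : κ ∈ Set.Ioc 0 1) :
    ∃ q < g.Q, G.rent κ g.h (g.point 0 (q * g.d + 1)) + (Γ + g.s) <
      G.rent κ g.h (g.point 0 ((q + 1) * g.d + 1)) := by
  refine exists_add_lt_apply_succ (f := fun q => G.rent κ g.h (g.point 0 (q * g.d + 1))) ?_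
  have hmem {q : ℕ} (hq : q ≤ g.Q) : g.point 0 (q * g.d + 1) ∈ g.toScales.box :=
    g.mem_box_of_mem_points (g.point_mem_points g.M_pos
      ((Nat.succ_le_succ (Nat.mul_le_mul_right g.d hq)).trans (Nat.le_succ _)))
  have hfirst := S.rent_le hκ (hmem g.Q.zero_le)
  have hQΓ : 0 ≤ g.Q * Γ := mul_nonneg g.Q.cast_nonneg g.nonneg_Γ
  have hsteep := g.lt_Q_mul_s
  have hpos := g.nonneg_mul (u := C + x₀ + g.Y + g.w)
    (by linarith [g.nonneg_C, g.nonneg_x₀, g.Y_pos, g.w_pos])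
  have hlast := S.le_rent (b := g.Q * (Γ + 2 * g.s) - C - x₀) hκ
    (by linarith [g.nonneg_C, g.nonneg_x₀]) (hmem le_rfl) (by
      have hgrow := mul_le_mul_of_nonneg_left g.le_d_mul_w g.Q.cast_nonneg (α := ℝ)
      simp only [Grid.point]
      push_cast
      linarith [g.Y_pos, g.w_pos])
  simp only [Grid.point] at hfirst hlast ⊢
  push_cast at hfirst hlast ⊢
  simp only [zero_mul, zero_add, one_mul, ← add_assoc] at hfirst hlast ⊢
  linarith

/-- Across some block of rows the rent grows by more than the largest possible gain, so the curve
on which gain and rent add up to a suitable `β` does not leave this block. -/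
lemma exists_block (S : G.Sound g.toScales ε k i) (hκ : κ ∈ Set.Ioc 0 1) (hT : g.IsNet T)
    (hgain : ∀ p ∈ g.points, G.gain κ g.h p ∈ Set.Ioc 0 Γ) :
    ∃ β ∈ T, ∃ q < g.Q, (∀ p ∈ g.points, G.gain κ g.h p + G.rent κ g.h p ≠ β) ∧
      (∀ j < g.M, G.gain κ g.h (g.point j (q * g.d)) + G.rent κ g.h (g.point j (q * g.d)) < β) ∧
      ∀ j < g.M, β < G.gain κ g.h (g.point j (q * g.d + (g.d + 2))) +
        G.rent κ g.h (g.point j (q * g.d + (g.d + 2))) := by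
  obtain ⟨q, hq, hrent⟩ := S.exists_rent_add_lt hκ
  have hqd : q * g.d + (g.d + 2) ≤ g.Q * g.d + 2 := by nlinarith [Nat.mul_le_mul_right g.d hq]
  have hbox {j l : ℕ} (hj : j < g.M) (hl : l ≤ g.Q * g.d + 2) : g.point j l ∈ g.toScales.box :=
    g.mem_box_of_mem_points (g.point_mem_points hj hl)
  have hmono {j j' l l' : ℕ} (hj : j < g.M) (hj' : j' < g.M) (hll' : l < l')
      (hl' : l' ≤ g.Q * g.d + 2) : G.rent κ g.h (g.point j l) ≤ G.rent κ g.h (g.point j' l') :=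
    S.rent_mono hκ (hbox hj (hll'.le.trans hl')) (hbox hj' hl') (by
      have := g.w_pos
      simp only [Grid.point]
      gcongr)
  have hbox₀ := hbox g.M_pos (show q * g.d + 1 ≤ g.Q * g.d + 2 by omega)
  have hlow : g.b ≤ G.rent κ g.h (g.point 0 (q * g.d + 1)) :=
    S.le_rent hκ g.nonneg_b hbox₀ (g.mul_lt_Y.trans_le hbox₀.2.1)
  have hhigh : G.rent κ g.h (g.point 0 (q * g.d + 1)) ≤ c * (C + x₀ + g.Y') + 1 :=
    (S.rent_le hκ hbox₀).trans
      (add_le_add_left (g.mul_le_mul (add_le_add_right hbox₀.2.2 _)) 1)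
  obtain ⟨β, hβT, ⟨hlβ, hβl⟩, hβV⟩ := hT.2 (G.rent κ g.h (g.point 0 (q * g.d + 1)) + Γ)
    ⟨hlow.trans (le_add_of_nonneg_right g.nonneg_Γ), add_le_add_left hhigh Γ⟩
    (g.points.image fun p => G.gain κ g.h p + G.rent κ g.h p) card_image_le
  refine ⟨β, hβT, q, hq, fun p hp h => hβV (mem_image.2 ⟨p, hp, h⟩), fun j hj => ?_, fun j hj => ?_⟩
  · have := (hgain _ (g.point_mem_points hj (l := q * g.d) (by omega))).2
    linarith [hmono hj g.M_pos (q * g.d).lt_succ_self (by omega)]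
  · have := (hgain _ (g.point_mem_points hj hqd)).1
    have hstep : (q + 1) * g.d + 1 < q * g.d + (g.d + 2) := by rw [add_one_mul]; omega
    linarith [hmono g.M_pos hj hstep hqd]

lemma gain_add_rent_le (S : G.Sound g.toScales ε k i) (hκ : κ ∈ Set.Ioc 0 1) {j j' l l' : ℕ}
    (hjj' : j < j') (hll' : l < l') (hp : g.point j l ∈ g.points) (hp' : g.point j' l' ∈ g.points)
    (hboth : ∀ p ∈ g.points, G.bundle k (.additive κ κ) p ∅ = (true, true)) :
    G.gain κ g.h (g.point j l) + G.rent κ g.h (g.point j l) ≤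
      G.gain κ g.h (g.point j' l') + G.rent κ g.h (g.point j' l') := by
  have hbox := g.mem_box_of_mem_points hp
  have hbox' := g.mem_box_of_mem_points hp'
  have hw := g.w_pos
  exact add_le_add
    (S.gain_mono hκ hbox hbox' (by simp only [Grid.point]; gcongr) (hboth _ hp) (hboth _ hp'))
    (S.rent_mono hκ hbox hbox' (by simp only [Grid.point]; gcongr))

lemma not_separated (S : G.Sound g.toScales ε k i) {t : RootType} (ht : t.Admissible ε g.A)
    {f : FlipKind V} {j j' l l' : ℕ} (hjj' : j < j') (hj' : j' < g.M) (hl : l < g.Q * g.d + 2)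
    (hl' : l' < g.Q * g.d + 2) (hf : G.IsFlip i t (g.point j l) (g.point j (l + 1)) f)
    (hf' : G.IsFlip i t (g.point j' l') (g.point j' (l' + 1)) f) :
    |((j : ℤ) + l) - (j' + l')| ≤ 1 ∨ |((j : ℤ) - l) - (j' - l')| ≤ 1 := by
  rw [g.point_add_one] at hf hf'
  have hnonneg {j l : ℕ} (hj : j < g.M) (hl : l < g.Q * g.d + 2) : 0 ≤ g.point j l :=
    g.nonneg_of_mem_box (g.mem_box_of_mem_points (g.point_mem_points hj hl.le))
  have hne : (g.point j l).1 ≠ (g.point j' l').1 := by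
    simp [Grid.point, g.w_pos.ne', hjj'.ne]
  refine (S.abs_le_of_isFlip ht (hnonneg (hjj'.trans hj') hl) (hnonneg hj' hl') g.w_pos.le hne
    hf hf').imp (fun h => g.abs_le_one_of_abs_mul_le ?_) fun h => g.abs_le_one_of_abs_mul_le ?_ <;>
  · convert h using 2
    simp only [Grid.point]
    push_cast
    ring

/-- Otherwise the gain would be at most `γ` on the mesh, and the curve on which gain and rent add up
to some `β` would have flips of one kind that are too far apart. -/
lemma holderA_corner_eq [Fintype V] {g : Grid (Fintype.card (FlipKind V)) ε c C Γ x₀}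
    (S : G.Sound g.toScales ε k i) (hκ : κ ∈ Set.Ioc 0 1) {γ : ℝ} (hγ : γ ∈ Set.Icc 0 Γ)
    (hT : g.IsNet T) (hboth : ∀ p ∈ g.points, G.bundle k (.additive κ κ) p ∅ = (true, true))
    (hcorner : G.bundle k (.additive κ κ) g.corner ∅ = (true, true))
    (htoggle : ∀ β ∈ T, ∀ p ∈ g.points, ToggleInvariant {k, i}ᶜ (G.holderA (.coupled g.A β) p)) :
    G.holderA (.additive γ κ) g.corner ∅ = k := by
  by_contra hrefuse
  have hgain (p) (hp : p ∈ g.points) : G.gain κ g.h p ∈ Set.Ioc 0 Γ :=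
    ⟨S.gain_pos hκ (g.mem_box_of_mem_points hp) (hboth p hp),
      (S.gain_mono hκ (g.mem_box_of_mem_points hp) g.corner_mem_box (g.fst_lt_of_mem_points hp)
        (hboth p hp) hcorner).trans
        ((S.gain_le hκ hγ.1 g.corner_mem_box hcorner hrefuse).trans hγ.2)⟩
  obtain ⟨β, hβT, q, hq, hne, hbot, htop⟩ := S.exists_block hκ hT hgain
  have hqd : q * g.d + (g.d + 2) ≤ g.Q * g.d + 2 := by nlinarith [Nat.mul_le_mul_right g.d hq]
  have hβ : g.b ≤ β := hT.1 β hβT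
  have hβ₀ : 0 ≤ β := g.nonneg_b.trans hβ
  have hAβ := g.A_le_mul β hβ
  have hmem {j l : ℕ} (hj : j < g.M) (hl : l ≤ q * g.d + (g.d + 2)) : g.point j l ∈ g.points :=
    g.point_mem_points hj (hl.trans hqd)
  have hholder {p : ℝ × ℝ} (hp : p ∈ g.points) := S.lt_gain_add_rent_iff hκ hβ₀ hAβ
    (g.mem_box_of_mem_points hp) (hboth p hp) (hne p hp)
  obtain ⟨j, j', l, l', f, hjj', hj', hl, hl', hf, hf', hsep, hsep'⟩ :=
    exists_separated_crossings (L := q * g.d)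
      (P := fun j l => β < G.gain κ g.h (g.point j l) + G.rent κ g.h (g.point j l))
      (R := fun j l => G.IsFlip i (.coupled g.A β) (g.point j l) (g.point j (l + 1))) g.le_M
      (fun j hj => (hbot j hj).not_gt) htop
      (fun j j' l l' hjj' hj' hll' hl' h => h.trans_le <|
        S.gain_add_rent_le hκ hjj' hll' (hmem (hjj'.trans hj') (hll'.le.trans hl')) (hmem hj' hl')
          hboth)
      fun j hj l hl hP hP' => by
        have hp := hmem hj hl.le
        have hp' := hmem hj (Nat.succ_le_of_lt hl)
        exact S.exists_isFlip hAβ (g.two_mul_A_lt.trans_le hβ) (g.mem_box_of_mem_points hp)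
          (g.mem_box_of_mem_points hp') (htoggle β hβT _ hp) (htoggle β hβT _ hp')
          (hP ∘ (hholder hp).1) ((hholder hp').2 hP')
  have ht := RootType.Admissible.coupled (zero_le_one.trans g.one_lt_A.le) hβ₀ hAβ
  exact (S.not_separated ht hjj' hj' (hl.trans_le hqd) (hl'.trans_le hqd) hf hf').elim
    hsep.not_ge hsep'.not_ge

end PairModel.Sound

end Grid

/-! ### Truthful and approximate mechanisms -/

section Mechanism

variable {n m : ℕ} {M : Mechanism n m} {ε c C E : ℝ} {D : Fin n → Set (Cost m)}

/-- The additive cost function with processing times `w`. -/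
def additiveCost (w : Fin m → ℝ) : Cost m := fun S => ∑ τ ∈ S, w τ

/-- The cost function with processing times `w` and a discount `d` on the pair of tasks `a`, `b`. -/
def discountedCost (w : Fin m → ℝ) (a b : Fin m) (d : ℝ) : Cost m := fun S =>
  additiveCost w S - if a ∈ S ∧ b ∈ S then d else 0

/-- The profile of additive costs with processing times `W`. -/
def additiveProfile (W : Fin n → Fin m → ℝ) : Profile n m := fun ℓ => additiveCost (W ℓ)

/-- Additive costs, and those for which some task `a`, which takes time at most `E` and is much
cheaper than another task `b`, is free on top of `b`. -/
def nearAdditive (m : ℕ) (ε E : ℝ) : Set (Cost m) :=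
  {v | IsAdditive v ∨ ∃ (w : Fin m → ℝ) (a b : Fin m), a ≠ b ∧ 0 ≤ w ∧ w a ≤ E ∧
    w a ≤ ε * w b ∧ v = discountedCost w a b (w a)}

lemma isAdditive_additiveCost {w : Fin m → ℝ} (hw : 0 ≤ w) : IsAdditive (additiveCost w) :=
  ⟨⟨sum_empty, fun _ _ hST => sum_le_sum_of_subset_of_nonneg hST fun τ _ _ => hw τ⟩,
    fun S => by simp [additiveCost]⟩

lemma discountedCost_zero (w : Fin m → ℝ) (a b : Fin m) :
    discountedCost w a b 0 = additiveCost w := by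
  funext S
  simp [discountedCost]

lemma additiveProfile_mem {k : Fin n} {W : Fin n → Fin m → ℝ} (hW : 0 ≤ W) (ℓ : Fin n) :
    additiveProfile W ℓ ∈ oneMachineDomain k (nearAdditive m ε E) ℓ :=
  ⟨fun _ => Or.inl (isAdditive_additiveCost (hW ℓ)), fun _ => isAdditive_additiveCost (hW ℓ)⟩

lemma mem_bundle {B : Allocation n m} {ℓ : Fin n} {τ : Fin m} : τ ∈ B.bundle ℓ ↔ B τ = ℓ := by
  simp [Allocation.bundle]

namespace Mechanism

lemma TruthfulOn.weak_monotone (hT : M.TruthfulOn D) {P P' : Profile n m} (hP : ∀ j, P j ∈ D j)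
    (hP' : ∀ j, P' j ∈ D j) {ℓ : Fin n} (hag : ∀ j ≠ ℓ, P j = P' j) :
    P ℓ ((M.alloc P).bundle ℓ) + P' ℓ ((M.alloc P').bundle ℓ) ≤
      P ℓ ((M.alloc P').bundle ℓ) + P' ℓ ((M.alloc P).bundle ℓ) := by
  have h := hT ℓ P hP (P' ℓ) (hP' ℓ)
  have h' := hT ℓ P' hP' (P ℓ) (hP ℓ)
  rw [Function.update_eq_iff.2 ⟨rfl, hag⟩] at h
  rw [Function.update_eq_iff.2 ⟨rfl, fun j hj => (hag j hj).symm⟩] at h'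
  simp only [utility] at h h'
  linarith

/-- By weak monotonicity, the total decrease of the processing times of the tasks that the root
gives up is not positive. -/
lemma TruthfulOn.alloc_eq_of_lt {k : Fin n}
    (hT : M.TruthfulOn (oneMachineDomain k (nearAdditive m ε E))) {W W' : Fin n → Fin m → ℝ}
    (hW : 0 ≤ W) (hW' : 0 ≤ W') (hag : ∀ ℓ ≠ k, W ℓ = W' ℓ)
    (hall : ∀ τ, M.alloc (additiveProfile W) τ = k)
    (hlt : ∀ τ, M.alloc (additiveProfile W') τ ≠ k → W' k τ < W k τ) (τ : Fin m) :
    M.alloc (additiveProfile W') τ = k := by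
  have hwmon := hT.weak_monotone (additiveProfile_mem hW) (additiveProfile_mem hW')
    fun j hj => congrArg additiveCost (hag j hj)
  have huniv : (M.alloc (additiveProfile W)).bundle k = univ :=
    eq_univ_of_forall fun τ => mem_bundle.2 (hall τ)
  simp only [huniv, additiveProfile, additiveCost] at hwmon
  set B := (M.alloc (additiveProfile W')).bundle k with hB
  by_contra hτ
  have hpos : 0 < ∑ τ ∈ univ \ B, (W k τ - W' k τ) :=
    sum_pos (fun τ hτ => sub_pos.2 (hlt τ (by simpa [hB, mem_bundle] using hτ)))
      ⟨τ, by simpa [hB, mem_bundle] using hτ⟩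
  rw [sum_sub_distrib] at hpos
  have hsum := sum_sdiff (subset_univ B) (f := W k)
  have hsum' := sum_sdiff (subset_univ B) (f := W' k)
  linarith

end Mechanism

lemma le_makespan (t : Profile n m) (B : Allocation n m) (ℓ : Fin n) :
    t ℓ (B.bundle ℓ) ≤ makespan t B :=
  le_ciSup (f := fun ℓ => t ℓ (B.bundle ℓ)) (Set.finite_range _).bddAbove ℓ

lemma opt_le (t : Profile n m) (B : Allocation n m) : opt t ≤ makespan t B :=
  ciInf_le (Set.finite_range _).bddBelow B

namespace Mechanism.ApproxOn

lemma load_le (hM : M.ApproxOn c (additiveDomain n m)) (hc : 0 ≤ c) {W : Fin n → Fin m → ℝ}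
    (hW : 0 ≤ W) {B : Allocation n m} {u : ℝ} (hB : ∀ ℓ, ∑ τ ∈ B.bundle ℓ, W ℓ τ ≤ u)
    (ℓ : Fin n) : ∑ τ ∈ (M.alloc (additiveProfile W)).bundle ℓ, W ℓ τ ≤ c * u := by
  have : Nonempty (Fin n) := ⟨ℓ⟩
  calc ∑ τ ∈ (M.alloc (additiveProfile W)).bundle ℓ, W ℓ τ
      ≤ makespan (additiveProfile W) (M.alloc (additiveProfile W)) :=
        le_makespan (additiveProfile W) _ ℓ
    _ ≤ c * opt (additiveProfile W) := hM _ fun ℓ => isAdditive_additiveCost (hW ℓ)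
    _ ≤ c * u := mul_le_mul_of_nonneg_left ((opt_le _ B).trans (ciSup_le hB)) hc

lemma task_le (hM : M.ApproxOn c (additiveDomain n m)) (hc : 0 ≤ c) {W : Fin n → Fin m → ℝ}
    (hW : 0 ≤ W) {B : Allocation n m} {u : ℝ} (hB : ∀ ℓ, ∑ τ ∈ B.bundle ℓ, W ℓ τ ≤ u)
    (τ : Fin m) : W (M.alloc (additiveProfile W) τ) τ ≤ c * u :=
  (single_le_sum (f := W _) (fun τ _ => hW _ τ) (mem_bundle.2 rfl)).trans
    (hM.load_le hc hW hB _)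

lemma one_le [NeZero m] (hM : M.ApproxOn c (additiveDomain n m)) : 1 ≤ c := by
  set P : Profile n m := additiveProfile fun _ _ => 1
  have : Nonempty (Allocation n m) := ⟨M.alloc P⟩
  have hopt : 1 ≤ opt P := by
    refine le_ciInf fun B => le_trans ?_ (le_makespan P B (B 0))
    have hmem : (0 : Fin m) ∈ B.bundle (B 0) := mem_bundle.2 rfl
    simpa [P, additiveProfile, additiveCost] using ⟨_, hmem⟩
  have hc : opt P ≤ c * opt P :=
    (opt_le P (M.alloc P)).trans (hM P fun _ => isAdditive_additiveCost fun _ => zero_le_one)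
  exact le_of_mul_le_mul_right ((one_mul _).trans_le hc) (by linarith)

end Mechanism.ApproxOn

end Mechanism

/-! ### The pair model of a mechanism -/

section PairFrame

variable {n m : ℕ} {M : Mechanism n m} {ε c C x₀ E : ℝ}

/-- The part of the pair of tasks `a`, `b` that the machine `ℓ` receives. -/
def Allocation.part (B : Allocation n m) (a b : Fin m) (ℓ : Fin n) : Bool × Bool :=
  (decide (B a = ℓ), decide (B b = ℓ))

lemma sum_bundle_eq {a b : Fin m} (hab : a ≠ b) (B : Allocation n m) (ℓ : Fin n)
    (w : Fin m → ℝ) :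
    ∑ τ ∈ B.bundle ℓ, w τ =
      ∑ τ ∈ B.bundle ℓ \ {a, b}, w τ + pairCost (w a, w b) (B.part a b ℓ) := by
  rw [← sum_inter_add_sum_sdiff (B.bundle ℓ) {a, b}, add_comm, inter_comm]
  congr 1
  rw [Allocation.bundle, ← filter_mem_eq_inter]
  simp [sum_filter, sum_pair hab, pairCost, Allocation.part]

lemma Mechanism.TruthfulOn.weak_monotone_pair {D : Fin n → Set (Cost m)} (hT : M.TruthfulOn D)
    {P P' : Profile n m} (hP : ∀ j, P j ∈ D j) (hP' : ∀ j, P' j ∈ D j) {ℓ : Fin n}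
    (hag : ∀ j ≠ ℓ, P j = P' j) {w w' : Fin m → ℝ} (hw : P ℓ = additiveCost w)
    (hw' : P' ℓ = additiveCost w') {a b : Fin m} (hab : a ≠ b)
    (hww' : ∀ τ, τ ≠ a → τ ≠ b → w τ = w' τ) :
    pairCost (w a, w b) ((M.alloc P).part a b ℓ) + pairCost (w' a, w' b) ((M.alloc P').part a b ℓ) ≤
      pairCost (w a, w b) ((M.alloc P').part a b ℓ) +
        pairCost (w' a, w' b) ((M.alloc P).part a b ℓ) := by
  have h := hT.weak_monotone hP hP' hag
  have hrest (B : Finset (Fin m)) : ∑ τ ∈ B \ {a, b}, w τ = ∑ τ ∈ B \ {a, b}, w' τ :=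
    sum_congr rfl fun τ hτ => by
      simp only [mem_sdiff, mem_insert, mem_singleton, not_or] at hτ
      exact hww' τ hτ.2.1 hτ.2.2
  simp only [hw, hw', additiveCost, sum_bundle_eq hab, hrest] at h
  linarith

/-- The data that are fixed in a pair model: the root `k`, the leaf `i`, the two tasks `a` and `b`,
the processing times `W`, and the processing time `h` of the other machines for `b`. The entries of
`W` for the task `b`, and those of `k` and `i` for the task `a`, are immaterial. -/
structure PairFrame (n m : ℕ) where
  (k i : Fin n)
  (a b : Fin m)
  W : Fin n → Fin m → ℝ
  h : ℝ
  ne : i ≠ k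
  ne_task : a ≠ b

namespace PairFrame

/-- The processing times when the root has type `t`, the leaf has costs `p` and the machines in `σ`
have the task `b` for free. -/
def weights (F : PairFrame n m) (t : RootType) (p : ℝ × ℝ) (σ : Finset (Fin n)) (ℓ : Fin n)
    (τ : Fin m) : ℝ :=
  if τ = F.a then if ℓ = F.k then t.a else if ℓ = F.i then p.1 else F.W ℓ F.a
  else if τ = F.b then taskCost F.k F.i F.h t.b p.2 σ ℓ
  else F.W ℓ τ

/-- The profile with the processing times `weights` and the discount of the root type. -/
def profile (F : PairFrame n m) (t : RootType) (p : ℝ × ℝ) (σ : Finset (Fin n)) : Profile n m :=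
  Function.update (additiveProfile (F.weights t p σ)) F.k
    (discountedCost (F.weights t p σ F.k) F.a F.b t.disc)

/-- The pair model that a mechanism induces on a frame. -/
def model (F : PairFrame n m) (M : Mechanism n m) : PairModel (Fin n) where
  holderA t p σ := M.alloc (F.profile t p σ) F.a
  holderB t p σ := M.alloc (F.profile t p σ) F.b
  pay t p σ := M.pay (F.profile t p σ) F.k -
    ∑ τ ∈ (M.alloc (F.profile t p σ)).bundle F.k \ {F.a, F.b}, F.W F.k τ

variable {F : PairFrame n m} {t t' : RootType} {p p' : ℝ × ℝ} {σ : Finset (Fin n)}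

lemma weights_a (ℓ : Fin n) :
    F.weights t p σ ℓ F.a = if ℓ = F.k then t.a else if ℓ = F.i then p.1 else F.W ℓ F.a :=
  if_pos rfl

lemma weights_b (ℓ : Fin n) :
    F.weights t p σ ℓ F.b = taskCost F.k F.i F.h t.b p.2 σ ℓ := by
  simp [weights, F.ne_task.symm]

lemma weights_of_ne {τ : Fin m} (ha : τ ≠ F.a) (hb : τ ≠ F.b) (ℓ : Fin n) :
    F.weights t p σ ℓ τ = F.W ℓ τ := by
  simp [weights, ha, hb]

lemma weights_nonneg (hW : 0 ≤ F.W) (hh : 0 ≤ F.h) (hta : 0 ≤ t.a) (htb : 0 ≤ t.b) (hp : 0 ≤ p) :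
    0 ≤ F.weights t p σ := by
  intro ℓ τ
  have hp₁ : 0 ≤ p.1 := hp.1
  have hp₂ : 0 ≤ p.2 := hp.2
  have hWℓ := hW ℓ
  simp only [Pi.zero_apply, weights, taskCost]
  split_ifs <;> first | assumption | exact le_rfl | exact hWℓ _

lemma profile_of_ne {ℓ : Fin n} (hℓ : ℓ ≠ F.k) :
    F.profile t p σ ℓ = additiveCost (F.weights t p σ ℓ) :=
  Function.update_of_ne hℓ _ _

lemma profile_root :
    F.profile t p σ F.k = discountedCost (F.weights t p σ F.k) F.a F.b t.disc :=
  Function.update_self _ _ _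

lemma profile_additive (x y : ℝ) :
    F.profile (.additive x y) p σ = additiveProfile (F.weights (.additive x y) p σ) := by
  rw [profile, RootType.additive_disc, discountedCost_zero]
  exact Function.update_eq_self _ _

lemma profile_mem (hW : 0 ≤ F.W) (hh : 0 ≤ F.h) (ht : t.Admissible ε E) (hp : 0 ≤ p) (ℓ : Fin n) :
    F.profile t p σ ℓ ∈ oneMachineDomain F.k (nearAdditive m ε E) ℓ := by
  obtain ⟨ha, hb, hdisc⟩ := ht
  have hnonneg := F.weights_nonneg (σ := σ) hW hh ha hb hp
  refine ⟨?_, fun hℓ => ?_⟩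
  · rintro rfl
    rw [profile_root]
    rcases hdisc with hdisc | ⟨hdisc, hE, hε⟩
    · rw [hdisc, discountedCost_zero]
      exact Or.inl (isAdditive_additiveCost (hnonneg _))
    · have hwa : F.weights t p σ F.k F.a = t.a := by simp [weights_a]
      have hwb : F.weights t p σ F.k F.b = t.b := by rw [weights_b, taskCost_root]
      exact Or.inr ⟨_, F.a, F.b, F.ne_task, hnonneg _, by rwa [hwa], by rwa [hwa, hwb],
        by rw [hdisc, hwa]⟩
  · rw [profile_of_ne hℓ]
    exact isAdditive_additiveCost (hnonneg ℓ)

lemma profile_root_bundle (B : Allocation n m) :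
    F.profile t p σ F.k (B.bundle F.k) =
      ∑ τ ∈ B.bundle F.k \ {F.a, F.b}, F.W F.k τ + t.cost (B.part F.a F.b F.k) := by
  have hrest : ∑ τ ∈ B.bundle F.k \ {F.a, F.b}, F.weights t p σ F.k τ =
      ∑ τ ∈ B.bundle F.k \ {F.a, F.b}, F.W F.k τ := sum_congr rfl fun τ hτ => by
    simp only [mem_sdiff, mem_insert, mem_singleton, not_or] at hτ
    exact weights_of_ne hτ.2.1 hτ.2.2 _
  rw [profile_root, discountedCost, additiveCost, sum_bundle_eq F.ne_task, hrest, weights_a,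
    weights_b, taskCost_root, if_pos rfl, add_sub_assoc, RootType.cost]
  simp [mem_bundle, Allocation.part]

lemma model_utility : (F.model M).utility F.k t t' p σ =
    M.utility F.k (F.profile t p σ F.k) (F.profile t' p σ) := by
  rw [PairModel.utility, Mechanism.utility, profile_root_bundle, ← sub_sub]
  rfl

lemma update_profile :
    Function.update (F.profile t p σ) F.k (F.profile t' p σ F.k) = F.profile t' p σ := by
  refine Function.update_eq_iff.2 ⟨rfl, fun ℓ hℓ => ?_⟩
  rw [profile_of_ne hℓ, profile_of_ne hℓ]
  congr 1
  funext τ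
  simp [weights, taskCost, hℓ]

lemma profile_congr {ℓ : Fin n} (hℓ : ℓ ≠ F.i) : F.profile t p σ ℓ = F.profile t p' σ ℓ := by
  have hw : F.weights t p σ ℓ = F.weights t p' σ ℓ := by
    funext τ
    simp [weights, taskCost, hℓ]
  by_cases hk : ℓ = F.k
  · subst hk
    rw [profile_root, profile_root, hw]
  · rw [profile_of_ne hk, profile_of_ne hk, hw]

lemma sum_competitor_le (hW : 0 ≤ F.W) (hC : ∑ τ, F.W F.k τ ≤ C) (hw : 0 ≤ F.weights t p σ)
    (z ℓ : Fin n) :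
    ∑ τ ∈ Allocation.bundle (fun τ => if τ = F.a then F.i else if τ = F.b then z else F.k) ℓ,
      F.weights t p σ ℓ τ ≤ C + p.1 + taskCost F.k F.i F.h t.b p.2 σ z := by
  set B : Allocation n m := fun τ => if τ = F.a then F.i else if τ = F.b then z else F.k with hB
  have hrest : ∑ τ ∈ B.bundle ℓ \ {F.a, F.b}, F.weights t p σ ℓ τ ≤ C := by
    refine (sum_le_sum fun τ hτ => le_of_eq ?_).trans
      ((sum_le_sum_of_subset_of_nonneg (subset_univ _) fun τ _ _ => hW F.k τ).trans hC)
    simp only [mem_sdiff, mem_insert, mem_singleton, not_or, Allocation.bundle, mem_filter_univ]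
      at hτ
    obtain ⟨rfl, ha, hb⟩ := hτ
    simp [hB, weights_of_ne ha hb, ha, hb]
  have hi : 0 ≤ p.1 := by simpa [weights_a, F.ne] using hw F.i F.a
  have hz : 0 ≤ taskCost F.k F.i F.h t.b p.2 σ z := by simpa [weights_b] using hw z F.b
  have hpair : pairCost (F.weights t p σ ℓ F.a, F.weights t p σ ℓ F.b) (B.part F.a F.b ℓ) ≤
      p.1 + taskCost F.k F.i F.h t.b p.2 σ z := by
    simp only [pairCost, Allocation.part, hB, if_true, F.ne_task.symm, if_false, decide_eq_true_eq,
      weights_b]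
    refine add_le_add ?_ ?_ <;> split_ifs with hℓ
    · simp [← hℓ, weights_a, F.ne]
    · exact hi
    · rw [hℓ]
    · exact hz
  rw [sum_bundle_eq F.ne_task]
  linarith

lemma model_root_le (hT : M.TruthfulOn (oneMachineDomain F.k (nearAdditive m ε E))) (hW : 0 ≤ F.W)
    (hh : 0 ≤ F.h) (ht : t.Admissible ε E) (ht' : t'.Admissible ε E) (hp : 0 ≤ p) :
    (F.model M).utility F.k t t' p σ ≤ (F.model M).utility F.k t t p σ := by
  have h := hT F.k (F.profile t p σ) (profile_mem hW hh ht hp) (F.profile t' p σ F.k)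
    (profile_mem hW hh ht' hp _)
  rwa [update_profile, ← model_utility, ← model_utility] at h

lemma model_leaf_le (hT : M.TruthfulOn (oneMachineDomain F.k (nearAdditive m ε E))) (hW : 0 ≤ F.W)
    (hh : 0 ≤ F.h) (ht : t.Admissible ε E) (hp : 0 ≤ p) (hp' : 0 ≤ p') :
    pairCost p ((F.model M).bundle F.i t p σ) + pairCost p' ((F.model M).bundle F.i t p' σ) ≤
      pairCost p ((F.model M).bundle F.i t p' σ) + pairCost p' ((F.model M).bundle F.i t p σ) := by
  have h := hT.weak_monotone_pair (profile_mem (σ := σ) hW hh ht hp)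
    (profile_mem (σ := σ) hW hh ht hp') (fun _ => profile_congr) (profile_of_ne F.ne)
    (profile_of_ne F.ne) F.ne_task fun τ ha hb => by rw [weights_of_ne ha hb, weights_of_ne ha hb]
  simp only [weights_a, weights_b, if_neg F.ne, if_true, taskCost_leaf F.ne] at h
  exact h

lemma model_approx (hM : M.ApproxOn c (additiveDomain n m)) (hc : 0 ≤ c) (hW : 0 ≤ F.W)
    (hh : 0 ≤ F.h) (hC : ∑ τ, F.W F.k τ ≤ C) (hle : ∀ z, z ≠ F.k → z ≠ F.i → F.h ≤ F.W z F.a)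
    {a b : ℝ} (ha : 0 ≤ a) (hb : 0 ≤ b) (hp : 0 ≤ p) (z : Fin n) :
    taskCost F.k F.i F.h a p.1 ∅ ((F.model M).holderA (.additive a b) p σ) ≤
        c * (C + p.1 + taskCost F.k F.i F.h b p.2 σ z) ∧
      taskCost F.k F.i F.h b p.2 σ ((F.model M).holderB (.additive a b) p σ) ≤
        c * (C + p.1 + taskCost F.k F.i F.h b p.2 σ z) := by
  have hw : 0 ≤ F.weights (.additive a b) p σ := weights_nonneg hW hh ha hb hp
  have htask := hM.task_le hc hw (sum_competitor_le hW hC hw z)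
  rw [← profile_additive] at htask
  refine ⟨le_trans ?_ (htask F.a), (weights_b _).symm.trans_le (htask F.b)⟩
  simp only [model, weights_a, taskCost, notMem_empty, if_false]
  split_ifs with hk hi
  exacts [le_rfl, le_rfl, hle _ hk hi]

lemma sound {P : Scales c C x₀} (hT : M.TruthfulOn (oneMachineDomain F.k (nearAdditive m ε P.A)))
    (hM : M.ApproxOn c (additiveDomain n m)) (hW : 0 ≤ F.W) (hh : F.h = P.h)
    (hC : ∑ τ, F.W F.k τ ≤ C) (hle : ∀ z, z ≠ F.k → z ≠ F.i → F.h ≤ F.W z F.a) :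
    (F.model M).Sound P ε F.k F.i where
  ne := F.ne
  root := model_root_le hT hW (hh ▸ P.h_pos.le)
  leaf := model_leaf_le hT hW (hh ▸ P.h_pos.le)
  approx := by
    rw [← hh]
    exact model_approx hM (zero_le_one.trans P.one_le_c) hW (hh ▸ P.h_pos.le) hC hle

lemma profile_congr_off {W : Fin n → Fin m → ℝ} {ℓ : Fin n} (hWF : ∀ τ, W ℓ τ = F.W ℓ τ)
    {σ' : Finset (Fin n)} (hσ : ℓ ∈ σ ↔ ℓ ∈ σ') :
    F.profile t p σ ℓ = PairFrame.profile { F with W := W } t p σ' ℓ := by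
  have hw : F.weights t p σ ℓ = PairFrame.weights { F with W := W } t p σ' ℓ := by
    funext τ
    simp [weights, taskCost, hσ, hWF]
  by_cases hk : ℓ = F.k
  · subst hk
    exact profile_root.trans (hw ▸ (profile_root (F := { F with W := W })).symm)
  · exact (profile_of_ne hk).trans (hw ▸ (profile_of_ne (F := { F with W := W }) hk).symm)

/-- The second task is worth at most `h`, which does not make up for a raise of more than `h`. -/
lemma holderA_ne_of_lt (hT : M.TruthfulOn (oneMachineDomain F.k (nearAdditive m ε E)))
    {W : Fin n → Fin m → ℝ} (hF : 0 ≤ F.W) (hW : 0 ≤ W) (hh : 0 ≤ F.h) {z : Fin n} (hzk : z ≠ F.k)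
    (hzi : z ≠ F.i) (hWF : ∀ ℓ τ, (ℓ, τ) ≠ (z, F.a) → W ℓ τ = F.W ℓ τ)
    (hlt : F.W z F.a + F.h < W z F.a) (ht : t.Admissible ε E) (hp : 0 ≤ p) {σ' : Finset (Fin n)}
    (hσ : ∀ j ≠ z, j ∈ σ ↔ j ∈ σ') (hne : (F.model M).holderA t p σ ≠ z) :
    (PairFrame.model { F with W := W } M).holderA t p σ' ≠ z := by
  set F' : PairFrame n m := { F with W := W }
  intro heq
  have hag (ℓ : Fin n) (hℓ : ℓ ≠ z) : F.profile t p σ ℓ = F'.profile t p σ' ℓ :=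
    profile_congr_off (fun τ => hWF ℓ τ (by simp [hℓ])) (hσ ℓ hℓ)
  have hmono := hT.weak_monotone_pair (profile_mem (σ := σ) hF hh ht hp)
    (profile_mem (F := F') (σ := σ') hW hh ht hp) hag (profile_of_ne hzk)
    (profile_of_ne (F := F') hzk) F.ne_task fun τ ha hb => by
      rw [weights_of_ne ha hb, weights_of_ne (F := F') ha hb]
      exact (hWF z τ (by simp [ha])).symm
  have hw_a : F'.weights t p σ' z F.a = W z F.a := by
    rw [weights_a (F := F'), if_neg hzk, if_neg hzi]
  have hw_b : F'.weights t p σ' z F.b = if z ∈ σ' then 0 else F.h := by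
    rw [weights_b (F := F'), taskCost, if_neg hzk, if_neg hzi]
  have hne' : M.alloc (F.profile t p σ) F.a ≠ z := hne
  have heq' : M.alloc (F'.profile t p σ') F.a = z := heq
  simp only [hw_a, hw_b, weights_a, weights_b, taskCost, if_neg hzk, if_neg hzi, pairCost,
    Allocation.part, hne', heq', decide_true, decide_false, Bool.false_eq_true, if_true, if_false]
    at hmono
  split_ifs at hmono <;> linarith

lemma holderA_insert_iff_of_lt (hT : M.TruthfulOn (oneMachineDomain F.k (nearAdditive m ε E)))
    {W : Fin n → Fin m → ℝ} (hF : 0 ≤ F.W) (hW : 0 ≤ W) (hh : 0 ≤ F.h) {z : Fin n} (hzk : z ≠ F.k)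
    (hzi : z ≠ F.i) (hWF : ∀ ℓ τ, (ℓ, τ) ≠ (z, F.a) → W ℓ τ = F.W ℓ τ)
    (hlt : F.W z F.a + F.h < W z F.a) (ht : t.Admissible ε E) (hp : 0 ≤ p)
    (hF_iff : ¬((F.model M).holderA t p σ = z ↔ (F.model M).holderA t p (insert z σ) = z)) :
    (PairFrame.model { F with W := W } M).holderA t p σ = z ↔
      (PairFrame.model { F with W := W } M).holderA t p (insert z σ) = z := by
  have hne {τ τ' : Finset (Fin n)} := holderA_ne_of_lt (σ := τ) (σ' := τ') hT hF hW hh hzk hzi hWF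
    hlt ht hp
  by_cases hz : (F.model M).holderA t p σ = z
  · have hz' := fun h => hF_iff (iff_of_true hz h)
    exact iff_of_false (hne (by simp +contextual) hz') (hne (fun _ _ => Iff.rfl) hz')
  · exact iff_of_false (hne (fun _ _ => Iff.rfl) hz) (hne (by simp +contextual) hz)

end PairFrame

end PairFrame

/-! ### Stars of machines -/

section Star

variable {n m : ℕ}

/-- The leaves: all machines but the root `k`. -/
abbrev Leaf (k : Fin n) : Type := {i : Fin n // i ≠ k}

/-- The tasks of a star: a first and a second task of each leaf, and spare tasks. -/
abbrev StarTask (k : Fin n) (m : ℕ) : Type := Leaf k ⊕ Leaf k ⊕ Fin (m - 2 * (n - 1))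

/-- The data that are fixed in the construction: names for the tasks, and the costs of the leaves
for the tasks of the other leaves, namely `X j ℓ` of the leaf `ℓ` for the first task of the leaf `j`
and `h` for all second tasks. -/
structure Star (k : Fin n) (m : ℕ) where
  e : Fin m ≃ StarTask k m
  h : ℝ
  X : Leaf k → Leaf k → ℝ
  nonneg_h : 0 ≤ h
  h_le_X : ∀ j ℓ, h ≤ X j ℓ

/-- The processing times of the root: the first tasks of the leaves in `J` take time `γ`, all other
tasks take time `κ`. -/
def rootWeight {k : Fin n} (J : Finset (Leaf k)) (γ κ : ℝ) : StarTask k m → ℝ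
  | .inl j => if j ∈ J then γ else κ
  | .inr _ => κ

section RootWeight

variable {k : Fin n} {γ κ γ' κ' : ℝ} {J : Finset (Leaf k)} {i : Leaf k}

lemma rootWeight_mem {I : Set ℝ} (hγ : γ ∈ I) (hκ : κ ∈ I) (τ : StarTask k m) :
    rootWeight J γ κ τ ∈ I := by
  rcases τ with j | j <;> simp only [rootWeight]
  · split_ifs <;> assumption
  · exact hκ

lemma rootWeight_lt (hγ : γ' < γ) (hκ : κ' < κ) (τ : StarTask k m) :
    rootWeight J γ' κ' τ < rootWeight J γ κ τ := by
  rcases τ with j | j <;> simp only [rootWeight]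
  · split_ifs <;> assumption
  · exact hκ

lemma rootWeight_insert {τ : StarTask k m} (hτ : τ ≠ .inl i) :
    rootWeight (insert i J) γ κ τ = rootWeight J γ κ τ := by
  rcases τ with j | j <;> simp only [rootWeight]
  simp [show j ≠ i from fun h => hτ (h ▸ rfl)]

end RootWeight

namespace Star

variable {k : Fin n} (s : Star k m)

/-- The processing times of the leaf `ℓ`, whose costs for its own tasks are `z ℓ`. -/
def leafWeight (z : Leaf k → ℝ × ℝ) (ℓ : Leaf k) : StarTask k m → ℝ
  | .inl j => if j = ℓ then (z ℓ).1 else s.X j ℓ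
  | .inr (.inl j) => if j = ℓ then (z ℓ).2 else s.h
  | .inr (.inr _) => 1

/-- The processing times of all machines. -/
def weights (J : Finset (Leaf k)) (γ κ : ℝ) (z : Leaf k → ℝ × ℝ) (ℓ : Fin n) (τ : Fin m) : ℝ :=
  if hℓ : ℓ = k then rootWeight J γ κ (s.e τ) else s.leafWeight z ⟨ℓ, hℓ⟩ (s.e τ)

/-- The pair frame of the root and the two tasks of the leaf `i`. -/
def frame (J : Finset (Leaf k)) (γ κ : ℝ) (z : Leaf k → ℝ × ℝ) (i : Leaf k) : PairFrame n m where
  k := k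
  i := i
  a := s.e.symm (.inl i)
  b := s.e.symm (.inr (.inl i))
  W := s.weights J γ κ z
  h := s.h
  ne := i.2
  ne_task := s.e.symm.injective.ne Sum.inl_ne_inr

/-- The root receives all the tasks. -/
def RootHoldsAll (M : Mechanism n m) (J : Finset (Leaf k)) (γ κ : ℝ) (z : Leaf k → ℝ × ℝ) : Prop :=
  ∀ τ, M.alloc (additiveProfile (s.weights J γ κ z)) τ = k

/-- When a leaf costs `p`, for `p` in `Z`, and the root has a coupled type with second cost in `T`,
no other leaf changes its mind about the first task once the second one is free for it. -/
def IsGeneric (M : Mechanism n m) (A : ℝ) (γ κ : Finset (Leaf k) → ℝ) (Z : Finset (ℝ × ℝ))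
    (T : Finset ℝ) : Prop :=
  ∀ J z i, (∀ ℓ, z ℓ ∈ Z) → ∀ p ∈ Z, ∀ β ∈ T, ToggleInvariant {k, i.1}ᶜ
    (((s.frame J (γ J) (κ J) z i).model M).holderA (.coupled A β) p)

variable {s} {M : Mechanism n m} {ε E c γ κ γ' κ' u A : ℝ} {J J' : Finset (Leaf k)} {i : Leaf k}
  {z : Leaf k → ℝ × ℝ}

lemma weights_root (τ : Fin m) : s.weights J γ κ z k τ = rootWeight J γ κ (s.e τ) :=
  dif_pos rfl

lemma weights_leaf (ℓ : Leaf k) (τ : Fin m) :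
    s.weights J γ κ z ℓ τ = s.leafWeight z ℓ (s.e τ) :=
  dif_neg ℓ.2

lemma weights_congr_root {ℓ : Fin n} (hℓ : ℓ ≠ k) :
    s.weights J γ κ z ℓ = s.weights J' γ' κ' z ℓ := by
  funext τ
  simp only [weights, hℓ, dite_false]

lemma le_leafWeight (hu : u ≤ 1) (huh : u ≤ s.h) (hz : ∀ ℓ, (u, u) ≤ z ℓ) (ℓ : Leaf k)
    (τ : StarTask k m) : u ≤ s.leafWeight z ℓ τ := by
  rcases τ with j | j | j <;> simp only [leafWeight]
  · split_ifs
    exacts [(hz ℓ).1, huh.trans (s.h_le_X j ℓ)]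
  · split_ifs
    exacts [(hz ℓ).2, huh]
  · exact hu

lemma weights_nonneg (hγ : 0 ≤ γ) (hκ : 0 ≤ κ) (hz : 0 ≤ z) : 0 ≤ s.weights J γ κ z := by
  intro ℓ τ
  by_cases hℓ : ℓ = k
  · subst hℓ
    exact (rootWeight_mem (I := Set.Ici 0) hγ hκ _).trans_eq (weights_root τ).symm
  · exact (le_leafWeight zero_le_one s.nonneg_h hz ⟨ℓ, hℓ⟩ _).trans_eq (weights_leaf ⟨ℓ, hℓ⟩ τ).symm

lemma leafWeight_update_of_ne {τ : StarTask k m} (ha : τ ≠ .inl i) (hb : τ ≠ .inr (.inl i))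
    (p : ℝ × ℝ) (ℓ : Leaf k) :
    s.leafWeight (Function.update z i p) ℓ τ = s.leafWeight z ℓ τ := by
  rcases τ with j | j | j <;> simp only [leafWeight]
  · obtain rfl | hℓ := eq_or_ne ℓ i
    · simp [show j ≠ ℓ from fun h => ha (h ▸ rfl)]
    · rw [Function.update_of_ne hℓ]
  · obtain rfl | hℓ := eq_or_ne ℓ i
    · simp [show j ≠ ℓ from fun h => hb (h ▸ rfl)]
    · rw [Function.update_of_ne hℓ]

lemma weights_update_of_ne (hJ : ∀ j ≠ i, j ∈ J' ↔ j ∈ J) {τ : Fin m}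
    (ha : s.e τ ≠ .inl i) (hb : s.e τ ≠ .inr (.inl i)) (p : ℝ × ℝ) (ℓ : Fin n) :
    s.weights J' γ κ (Function.update z i p) ℓ τ = s.weights J γ κ z ℓ τ := by
  by_cases hℓ : ℓ = k
  · subst hℓ
    rw [weights_root, weights_root]
    rcases hτ : s.e τ with j | j <;> simp only [rootWeight]
    simp only [hJ j fun h => ha (h ▸ hτ)]
  · lift ℓ to Leaf k using hℓ
    rw [weights_leaf, weights_leaf, leafWeight_update_of_ne ha hb]

lemma frame_weights (hJ : ∀ j ≠ i, j ∈ J' ↔ j ∈ J) (p : ℝ × ℝ) :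
    (s.frame J γ κ z i).weights (.additive (if i ∈ J' then γ else κ) κ) p ∅ =
      s.weights J' γ κ (Function.update z i p) := by
  funext ℓ τ
  by_cases ha : s.e τ = .inl i
  · obtain rfl := s.e.eq_symm_apply.2 ha
    refine ((s.frame J γ κ z i).weights_a ℓ).trans ?_
    by_cases hℓ : ℓ = k
    · subst hℓ
      simp [frame, weights_root, rootWeight]
    · lift ℓ to Leaf k using hℓ
      obtain rfl | hℓi := eq_or_ne ℓ i
      · simp [frame, weights_leaf, leafWeight, ℓ.2]
      · simp [frame, weights_leaf, leafWeight, ℓ.2, Subtype.coe_inj, hℓi, hℓi.symm]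
  by_cases hb : s.e τ = .inr (.inl i)
  · obtain rfl := s.e.eq_symm_apply.2 hb
    refine ((s.frame J γ κ z i).weights_b ℓ).trans ?_
    by_cases hℓ : ℓ = k
    · subst hℓ
      simp [frame, weights_root, rootWeight, taskCost]
    · lift ℓ to Leaf k using hℓ
      obtain rfl | hℓi := eq_or_ne ℓ i
      · simp [frame, weights_leaf, leafWeight, taskCost, ℓ.2]
      · simp [frame, weights_leaf, leafWeight, taskCost, ℓ.2, Subtype.coe_inj, hℓi, hℓi.symm]
  · rw [weights_update_of_ne hJ ha hb]
    exact PairFrame.weights_of_ne (fun h => ha (s.e.eq_symm_apply.1 h))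
      (fun h => hb (s.e.eq_symm_apply.1 h)) ℓ

lemma frame_profile (hJ : ∀ j ≠ i, j ∈ J' ↔ j ∈ J) (p : ℝ × ℝ) :
    (s.frame J γ κ z i).profile (.additive (if i ∈ J' then γ else κ) κ) p ∅ =
      additiveProfile (s.weights J' γ κ (Function.update z i p)) := by
  rw [PairFrame.profile_additive, frame_weights hJ]

end Star

/-! ### Generic stars -/

namespace Star

variable {k : Fin n} {M : Mechanism n m} {ε E h γ κ : ℝ} {J : Finset (Leaf k)} {i : Leaf k}
  {z : Leaf k → ℝ × ℝ} {e : Fin m ≃ StarTask k m} {hh : 0 ≤ h}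

/-- The star in which the costs `X` are determined by levels `N`; different levels yield costs that
differ by more than `h`. -/
def ofLevels (e : Fin m ≃ StarTask k m) {h : ℝ} (hh : 0 ≤ h) (N : Leaf k × Leaf k → ℕ) :
    Star k m where
  e := e
  h := h
  X j ℓ := h + (h + 1) * N (j, ℓ)
  nonneg_h := hh
  h_le_X _ _ := le_add_of_nonneg_right (by positivity)

lemma holderA_insert_iff_of_lt (hT : M.TruthfulOn (oneMachineDomain k (nearAdditive m ε E)))
    (hγ : 0 ≤ γ) (hκ : 0 ≤ κ) (hz : 0 ≤ z) {t : RootType} (ht : t.Admissible ε E) {p : ℝ × ℝ}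
    (hp : 0 ≤ p) {σ : Finset (Fin n)} {N N' : Leaf k × Leaf k → ℕ} {ζ : Leaf k} (hζ : ζ ≠ i)
    (hNN' : ∀ v ≠ (i, ζ), N v = N' v) (hlt : N (i, ζ) < N' (i, ζ))
    (hN : ¬((((ofLevels e hh N).frame J γ κ z i).model M).holderA t p σ = ζ ↔
      (((ofLevels e hh N).frame J γ κ z i).model M).holderA t p (insert ζ.1 σ) = ζ)) :
    (((ofLevels e hh N').frame J γ κ z i).model M).holderA t p σ = ζ ↔
      (((ofLevels e hh N').frame J γ κ z i).model M).holderA t p (insert ζ.1 σ) = ζ := by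
  refine ((ofLevels e hh N).frame J γ κ z i).holderA_insert_iff_of_lt
    (W := (ofLevels e hh N').weights J γ κ z) hT (weights_nonneg hγ hκ hz)
    (weights_nonneg hγ hκ hz) hh ζ.2 (Subtype.coe_ne_coe.2 hζ) (fun ℓ τ hne => ?_) ?_ ht hp hN
  · by_cases hℓ : ℓ = k
    · subst hℓ
      exact (weights_root (s := ofLevels e hh N') τ).trans
        (weights_root (s := ofLevels e hh N) τ).symm
    · lift ℓ to Leaf k using hℓ
      refine (weights_leaf ℓ τ).trans (.trans ?_ (weights_leaf ℓ τ).symm)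
      simp only [ofLevels]
      rcases hτ : e τ with j | j | j <;> simp only [leafWeight]
      congr 3
      refine congrArg _ (hNN' _ fun hv => hne ?_).symm
      obtain ⟨rfl, rfl⟩ := Prod.mk.inj hv
      exact Prod.ext rfl (e.eq_symm_apply.2 hτ)
  · have hw (N : Leaf k × Leaf k → ℕ) : (ofLevels e hh N).weights J γ κ z ζ (e.symm (.inl i)) =
        h + (h + 1) * N (i, ζ) := by
      simp [weights_leaf, ofLevels, leafWeight, hζ.symm]
    have hcast : (N (i, ζ) : ℝ) + 1 ≤ N' (i, ζ) := mod_cast hlt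
    change (ofLevels e hh N).weights J γ κ z ζ (e.symm (.inl i)) + h < _
    refine lt_of_lt_of_eq ?_ (hw N').symm
    rw [hw]
    nlinarith

/-- Each violation pins down one level, so that a counting argument provides levels without any. -/
lemma exists_isGeneric (hT : M.TruthfulOn (oneMachineDomain k (nearAdditive m ε E)))
    (e : Fin m ≃ StarTask k m) (hh : 0 ≤ h) {γ κ : Finset (Leaf k) → ℝ} (hγ : 0 ≤ γ) (hκ : 0 ≤ κ)
    {Z : Finset (ℝ × ℝ)} (hZ : ∀ p ∈ Z, 0 ≤ p) {A : ℝ} {T : Finset ℝ}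
    (ht : ∀ β ∈ T, (RootType.coupled A β).Admissible ε E) :
    ∃ s : Star k m, s.h = h ∧ s.IsGeneric M A γ κ Z T := by
  let Event := Leaf k × Leaf k × Finset (Leaf k) × (Leaf k → Z) × Z × T × Finset (Fin n)
  let model (N : Leaf k × Leaf k → Fin (Fintype.card Event + 1)) (J : Finset (Leaf k))
      (z : Leaf k → Z) (i : Leaf k) : PairModel (Fin n) :=
    ((ofLevels e hh fun v => (N v : ℕ)).frame J (γ J) (κ J) (fun ℓ => z ℓ) i).model M
  let bad : Event → (Leaf k × Leaf k → Fin (Fintype.card Event + 1)) → Prop :=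
    fun (i, ζ, J, z, p, β, σ) N => ζ ≠ i ∧
      ¬((model N J z i).holderA (.coupled A β) p σ = ζ ↔
        (model N J z i).holderA (.coupled A β) p (insert ζ.1 σ) = ζ)
  have hbad (v : Event) (N N' : Leaf k × Leaf k → Fin (Fintype.card Event + 1))
      (hNN' : ∀ u ≠ (v.1, v.2.1), N u = N' u) (hN : bad v N) (hN' : bad v N') : N = N' := by
    obtain ⟨i, ζ, J, z, p, β, σ⟩ := v
    have hcontra {N N'} := holderA_insert_iff_of_lt (J := J) (γ := γ J) (κ := κ J) (e := e)
      (hh := hh) (N := N) (N' := N') (σ := σ) hT (hγ J) (hκ J) (fun ℓ => hZ _ (z ℓ).2) (ht β β.2)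
      (hZ p p.2) hN.1
    funext u
    obtain rfl | hu := eq_or_ne u (i, ζ)
    · rcases lt_trichotomy (N (i, ζ)) (N' (i, ζ)) with hlt | heq | hlt
      · exact absurd (hcontra (fun u hu => congrArg Fin.val (hNN' u hu)) hlt hN.2) hN'.2
      · exact heq
      · exact absurd (hcontra (fun u hu => congrArg Fin.val (hNN' u hu).symm) hlt hN'.2) hN.2
    · exact hNN' u hu
  obtain ⟨N, hN⟩ := exists_forall_not_of_card_lt (by simp) (fun v : Event => (v.1, v.2.1)) bad hbad
  refine ⟨ofLevels e hh fun v => N v, rfl, fun J z i hz p hp β hβ ζ hζ σ _ => ?_⟩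
  simp only [mem_compl, mem_insert, mem_singleton, not_or] at hζ
  by_contra hiff
  exact hN (i, ⟨ζ, hζ.1⟩, J, fun ℓ => ⟨z ℓ, hz ℓ⟩, ⟨p, hp⟩, ⟨β, hβ⟩, σ)
    ⟨fun h => hζ.2 (congrArg Subtype.val h), hiff⟩

end Star

/-! ### Raising the costs of the root -/

namespace Star

variable {k : Fin n} {s : Star k m} {M : Mechanism n m} {ε E c γ κ γ' κ' : ℝ} {J : Finset (Leaf k)}
  {i : Leaf k} {z : Leaf k → ℝ × ℝ}

lemma rootHoldsAll_empty (hM : M.ApproxOn c (additiveDomain n m)) (hc : 0 ≤ c) (hγ : 0 ≤ γ)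
    (hκ : 0 ≤ κ) {u : ℝ} (hκu : c * (m * κ) < u) (hu : u ≤ 1) (huh : u ≤ s.h)
    (hz : ∀ ℓ, (u, u) ≤ z ℓ) : s.RootHoldsAll M ∅ γ κ z := by
  intro τ
  by_contra hτ
  have hu₀ : 0 ≤ u := (by positivity : 0 ≤ c * (m * κ)).trans hκu.le
  have hroot (τ : Fin m) : s.weights ∅ γ κ z k τ = κ := by
    rw [weights_root]
    cases s.e τ <;> simp [rootWeight]
  have hz₀ : 0 ≤ z := fun ℓ => (Prod.mk_le_mk.2 ⟨hu₀, hu₀⟩).trans (hz ℓ)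
  have hle := hM.task_le hc (s.weights_nonneg (J := ∅) hγ hκ hz₀) (B := fun _ => k) (u := m * κ)
    (fun ℓ => ?_) τ
  · refine hκu.not_ge (le_trans ?_ hle)
    exact (le_leafWeight hu huh hz ⟨_, hτ⟩ _).trans_eq (weights_leaf ⟨_, hτ⟩ τ).symm
  · obtain rfl | hℓ := eq_or_ne k ℓ
    · simp [hroot, Allocation.bundle]
    · simp only [Allocation.bundle, hℓ, filter_false, sum_empty]
      positivity

lemma RootHoldsAll.of_lt (h : s.RootHoldsAll M J γ κ z)
    (hT : M.TruthfulOn (oneMachineDomain k (nearAdditive m ε E))) (hz : 0 ≤ z) (hγ' : 0 ≤ γ')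
    (hκ' : 0 ≤ κ') (hγ : γ' < γ) (hκ : κ' < κ) : s.RootHoldsAll M J γ' κ' z :=
  hT.alloc_eq_of_lt (weights_nonneg (hγ'.trans hγ.le) (hκ'.trans hκ.le) hz)
    (weights_nonneg hγ' hκ' hz) (fun _ => weights_congr_root) h fun τ _ => by
      rw [weights_root, weights_root]
      exact rootWeight_lt hγ hκ _

lemma RootHoldsAll.insert_of_lt (h : s.RootHoldsAll M J γ κ z)
    (hT : M.TruthfulOn (oneMachineDomain k (nearAdditive m ε E))) (hz : 0 ≤ z) (hγ' : 0 ≤ γ')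
    (hκ' : 0 ≤ κ') (hγ : γ' < γ) (hκ : κ' < κ)
    (hi : M.alloc (additiveProfile (s.weights (insert i J) γ' κ' z)) (s.e.symm (.inl i)) = k) :
    s.RootHoldsAll M (insert i J) γ' κ' z :=
  hT.alloc_eq_of_lt (weights_nonneg (hγ'.trans hγ.le) (hκ'.trans hκ.le) hz)
    (weights_nonneg hγ' hκ' hz) (fun _ => weights_congr_root) h fun τ hτ => by
      have hne : s.e τ ≠ .inl i := fun h => hτ (by rw [s.e.eq_symm_apply.2 h, hi])
      rw [weights_root, weights_root, rootWeight_insert hne]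
      exact rootWeight_lt hγ hκ _

lemma sound_frame {C x₀ : ℝ} {P : Scales c C x₀} (hs : s.h = P.h)
    (hT : M.TruthfulOn (oneMachineDomain k (nearAdditive m ε P.A)))
    (hM : M.ApproxOn c (additiveDomain n m)) {Γ : ℝ} (hγ : γ ∈ Set.Icc 0 Γ) (hκ : κ ∈ Set.Icc 0 Γ)
    (hC : m * Γ ≤ C) (hz : 0 ≤ z) : ((s.frame J γ κ z i).model M).Sound P ε k i := by
  refine PairFrame.sound (F := s.frame J γ κ z i) hT hM (weights_nonneg hγ.1 hκ.1 hz) hs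
    (le_trans ?_ hC) fun ζ (hζ : ζ ≠ k) (hζi : ζ ≠ i) => ?_
  · have hle := sum_le_card_nsmul univ (s.weights J γ κ z k) Γ fun τ _ => by
      rw [weights_root]
      exact (rootWeight_mem (I := Set.Icc 0 Γ) hγ hκ _).2
    exact hle.trans_eq (by simp)
  · lift ζ to Leaf k using hζ
    refine (s.h_le_X i ζ).trans_eq (.trans ?_ (weights_leaf ζ _).symm)
    simp [frame, leafWeight, show i ≠ ζ from fun h => hζi (congrArg Subtype.val h).symm]

variable {C Γ x₀ : ℝ} {g : Grid (Fintype.card (FlipKind (Fin n))) ε c C Γ x₀} {T : Finset ℝ}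

lemma alloc_first_eq (hs : s.h = g.h)
    (hT : M.TruthfulOn (oneMachineDomain k (nearAdditive m ε g.A)))
    (hM : M.ApproxOn c (additiveDomain n m)) (hC : m * Γ ≤ C) (hΓ : 1 ≤ Γ)
    (hγ : γ ∈ Set.Icc 0 Γ) (hκ : κ ∈ Set.Ioc 0 1) (hnet : g.IsNet T)
    (hgen : ∀ β ∈ T, ∀ p ∈ g.points, ToggleInvariant {k, i.1}ᶜ
      (((s.frame (insert i J) γ κ z i).model M).holderA (.coupled g.A β) p))
    (hz : 0 ≤ z) (hi : i ∉ J) (hzi : z i = g.corner)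
    (hall : ∀ p ∈ insert g.corner g.points, s.RootHoldsAll M J γ κ (Function.update z i p)) :
    M.alloc (additiveProfile (s.weights (insert i J) γ κ z)) (s.e.symm (.inl i)) = k := by
  set F := s.frame (insert i J) γ κ z i
  have hboth (p : ℝ × ℝ) (hp : p ∈ insert g.corner g.points) :
      (F.model M).bundle k (.additive κ κ) p ∅ = (true, true) := by
    have hprofile := s.frame_profile (J := insert i J) (J' := J) (i := i) (γ := γ) (κ := κ) (z := z)
      (fun j hj => by simp [hj]) p
    rw [if_neg hi] at hprofile
    have hholds (τ : Fin m) : M.alloc (F.profile (.additive κ κ) p ∅) τ = k :=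
      (congrArg (M.alloc · τ) hprofile).trans (hall p hp τ)
    exact Prod.ext (decide_eq_true (hholds _)) (decide_eq_true (hholds _))
  have hsound : (F.model M).Sound g.toScales ε k i :=
    sound_frame hs hT hM hγ ⟨hκ.1.le, hκ.2.trans hΓ⟩ hC hz
  have hcorner := hsound.holderA_corner_eq hκ hγ hnet
    (fun p hp => hboth p (mem_insert_of_mem hp)) (hboth _ (mem_insert_self _ _)) hgen
  have hprofile := s.frame_profile (J := insert i J) (J' := insert i J) (i := i) (γ := γ) (κ := κ)
    (z := z) (fun _ _ => Iff.rfl) g.corner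
  rw [if_pos (mem_insert_self i J), ← hzi, Function.update_eq_self, hzi] at hprofile
  exact (congrArg (M.alloc · (s.e.symm (.inl i))) hprofile).symm.trans hcorner

/-- The leaf `i` moves from `p` to the corner while the root still holds all the tasks of the pair;
in the pair model of `i` the root then keeps the first task when its cost is raised. -/
lemma rootHoldsAll_of_strictAnti (hs : s.h = g.h)
    (hT : M.TruthfulOn (oneMachineDomain k (nearAdditive m ε g.A)))
    (hM : M.ApproxOn c (additiveDomain n m)) (hC : m * Γ ≤ C) (hΓ : 1 ≤ Γ) (hnet : g.IsNet T)
    {γ κ : ℕ → ℝ} (hγ : StrictAnti γ) (hκ : StrictAnti κ) (hγΓ : ∀ p, γ p ∈ Set.Icc 0 Γ)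
    (hκ1 : ∀ p, κ p ∈ Set.Ioc 0 1) (hκw : c * (m * κ 0) < min g.w 1)
    (hgen : s.IsGeneric M g.A (fun J => γ #J) (fun J => κ #J) (insert g.corner g.points) T) :
    ∀ J z, (∀ ℓ, z ℓ ∈ insert g.corner g.points) → (∀ j ∈ J, z j = g.corner) →
      s.RootHoldsAll M J (γ #J) (κ #J) z := by
  have hmin : (min g.w 1, min g.w 1) ≤ (g.w, g.Y) :=
    Prod.mk_le_mk.2 ⟨min_le_left _ _, (min_le_right _ _).trans g.one_lt_Y.le⟩
  intro J
  induction J using Finset.induction_on with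
  | empty =>
    intro z hz _
    exact rootHoldsAll_empty hM (zero_le_one.trans g.one_le_c) (hγΓ _).1 (hκ1 _).1.le hκw
      (min_le_right _ _) (hs ▸ (min_le_right _ _).trans g.one_lt_h.le) fun ℓ =>
        hmin.trans (g.le_of_mem (hz ℓ))
  | insert i J hi ih =>
    intro z hz hzJ
    have hz₀ : 0 ≤ z := fun ℓ => g.nonneg_of_mem (hz ℓ)
    have hγJ : γ (#J + 1) < γ #J := hγ (Nat.lt_succ_self _)
    have hκJ : κ (#J + 1) < κ #J := hκ (Nat.lt_succ_self _)
    have hall (p : ℝ × ℝ) (hp : p ∈ insert g.corner g.points) :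
        s.RootHoldsAll M J (γ (#J + 1)) (κ (#J + 1)) (Function.update z i p) := by
      have hmem : ∀ ℓ, Function.update z i p ℓ ∈ insert g.corner g.points :=
        (Function.forall_update_iff z fun _ q => q ∈ insert g.corner g.points).2
          ⟨hp, fun ℓ _ => hz ℓ⟩
      refine (ih _ hmem fun j hj => ?_).of_lt hT (fun ℓ => g.nonneg_of_mem (hmem ℓ)) (hγΓ _).1
        (hκ1 _).1.le hγJ hκJ
      rw [Function.update_of_ne (ne_of_mem_of_not_mem hj hi), hzJ j (mem_insert_of_mem hj)]
    rw [card_insert_of_notMem hi]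
    refine (ih z hz fun j hj => hzJ j (mem_insert_of_mem hj)).insert_of_lt hT hz₀ (hγΓ _).1
      (hκ1 _).1.le hγJ hκJ
      (alloc_first_eq hs hT hM hC hΓ (hγΓ _) (hκ1 _) hnet (fun β hβ p hp => ?_) hz₀ hi
        (hzJ i (mem_insert_self i J)) hall)
    rw [← card_insert_of_notMem hi]
    exact hgen (insert i J) z i hz p (mem_insert_of_mem hp) β hβ

end Star

end Star

/-! ### The lower bound -/

section LowerBound

variable {n m : ℕ} {M : Mechanism n m} {ε c x₀ : ℝ} {k : Fin n}

lemma nonempty_equiv_starTask (hm : 2 * (n - 1) ≤ m) (k : Fin n) :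
    Nonempty (Fin m ≃ StarTask k m) := by
  refine Fintype.card_eq.1 ?_
  simp only [Fintype.card_sum, Fintype.card_fin, Fintype.card_subtype_compl,
    Fintype.card_subtype_eq]
  omega

lemma sub_one_le_sum_rootWeight {γ κ : ℝ} (hγ : 1 ≤ γ) (hκ : 0 ≤ κ) :
    ((n - 1 : ℕ) : ℝ) ≤ ∑ τ : StarTask k m, rootWeight univ γ κ τ := by
  rw [Fintype.sum_sum_type]
  refine le_add_of_le_of_nonneg ?_ (sum_nonneg fun _ _ => hκ)
  simpa [rootWeight] using le_mul_of_one_le_right (n - 1 : ℕ).cast_nonneg hγ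

namespace Star

variable {s : Star k m} {γ κ : ℝ} {J : Finset (Leaf k)} {z : Leaf k → ℝ × ℝ}

/-- The allocation of the first tasks to their leaves and of all other tasks to the root. -/
def leafAllocation (s : Star k m) : Allocation n m := fun τ => (s.e τ).elim Subtype.val fun _ => k

lemma sum_leafAllocation_le (hκ : 0 ≤ κ) (hκx : m * κ ≤ x₀) (hz : ∀ j, (z j).1 ≤ x₀) (ℓ : Fin n) :
    ∑ τ ∈ s.leafAllocation.bundle ℓ, s.weights J γ κ z ℓ τ ≤ x₀ := by
  by_cases hℓ : ℓ = k
  · subst hℓ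
    have hle : ∀ τ ∈ s.leafAllocation.bundle ℓ, s.weights J γ κ z ℓ τ ≤ κ := fun τ hτ => by
      rw [weights_root]
      rcases hs : s.e τ with j | j
      · exact absurd (by simpa [mem_bundle, leafAllocation, hs] using hτ) j.2
      · exact le_rfl
    have hcard : (#(s.leafAllocation.bundle ℓ) : ℝ) ≤ m := mod_cast card_finset_fin_le _
    calc _ ≤ #(s.leafAllocation.bundle ℓ) • κ := sum_le_card_nsmul _ _ _ hle
      _ ≤ m * κ := (nsmul_eq_mul _ _).trans_le (mul_le_mul_of_nonneg_right hcard hκ)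
      _ ≤ x₀ := hκx
  · lift ℓ to Leaf k using hℓ
    have hbundle : s.leafAllocation.bundle ℓ = {s.e.symm (.inl ℓ)} := by
      ext τ
      rw [mem_singleton, s.e.eq_symm_apply, mem_bundle, leafAllocation]
      rcases s.e τ with j | j
      · simp [Subtype.coe_inj]
      · simp [ℓ.2.symm]
    simpa [hbundle, weights_leaf, leafWeight] using hz ℓ

lemma RootHoldsAll.sub_one_le (h : s.RootHoldsAll M univ γ κ z)
    (hM : M.ApproxOn c (additiveDomain n m)) (hc : 0 ≤ c) (hγ : 1 ≤ γ) (hκ : 0 ≤ κ)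
    (hκx : m * κ ≤ x₀) (hz : 0 ≤ z) (hzx : ∀ j, (z j).1 ≤ x₀) : ((n - 1 : ℕ) : ℝ) ≤ c * x₀ := by
  have hload := hM.load_le hc (weights_nonneg (zero_le_one.trans hγ) hκ hz)
    (sum_leafAllocation_le (s := s) (J := univ) hκ hκx hzx) k
  have huniv : (M.alloc (additiveProfile (s.weights univ γ κ z))).bundle k = univ :=
    eq_univ_of_forall fun τ => mem_bundle.2 (h τ)
  simp only [huniv, weights_root, s.e.sum_comp (rootWeight univ γ κ)] at hload
  exact (sub_one_le_sum_rootWeight hγ hκ).trans hload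

lemma exists_rootHoldsAll (hm : 2 * (n - 1) ≤ m) {Γ : ℝ}
    {g : Grid (Fintype.card (FlipKind (Fin n))) ε c (m * Γ) Γ x₀}
    (hT : M.TruthfulOn (oneMachineDomain k (nearAdditive m ε g.A)))
    (hM : M.ApproxOn c (additiveDomain n m)) (hΓ : 1 ≤ Γ) {γ κ : ℕ → ℝ} (hγ : StrictAnti γ)
    (hκ : StrictAnti κ) (hγΓ : ∀ p, γ p ∈ Set.Icc 0 Γ) (hκ1 : ∀ p, κ p ∈ Set.Ioc 0 1)
    (hκw : c * (m * κ 0) < min g.w 1) :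
    ∃ s : Star k m, s.RootHoldsAll M univ (γ #(univ : Finset (Leaf k)))
      (κ #(univ : Finset (Leaf k))) fun _ => g.corner := by
  obtain ⟨T, hnet⟩ := g.exists_isNet
  obtain ⟨e⟩ := nonempty_equiv_starTask hm k
  obtain ⟨s, hs, hgen⟩ := exists_isGeneric hT e g.h_pos.le (γ := fun J => γ #J)
    (κ := fun J => κ #J) (fun J => (hγΓ _).1) (fun J => (hκ1 _).1.le)
    (fun _ => g.nonneg_of_mem) fun β hβ => .coupled (zero_le_one.trans g.one_lt_A.le)
      (g.nonneg_b.trans (hnet.1 β hβ)) (g.A_le_mul β (hnet.1 β hβ))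
  exact ⟨s, rootHoldsAll_of_strictAnti hs hT hM le_rfl hΓ hnet hγ hκ hγΓ hκ1 hκw hgen univ _
    (fun _ => mem_insert_self _ _) fun _ _ => rfl⟩

end Star

lemma sub_one_le_mul [NeZero m] (hm : 2 * (n - 1) ≤ m) (k : Fin n) (hε : 0 < ε) (hc : 1 ≤ c)
    (hx : c < x₀) (H : ∀ E, 0 < E → ∃ M : Mechanism n m,
      M.TruthfulOn (oneMachineDomain k (nearAdditive m ε E)) ∧ M.ApproxOn c (additiveDomain n m)) :
    ((n - 1 : ℕ) : ℝ) ≤ c * x₀ := by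
  have hm₁ : (1 : ℝ) ≤ m := mod_cast NeZero.one_le
  have hm₀ : (0 : ℝ) < m := zero_lt_one.trans_le hm₁
  have hc₀ : 0 < c := zero_lt_one.trans_le hc
  obtain ⟨Γ, hΓ, hΓx⟩ := exists_between ((one_lt_div hc₀).2 hx)
  rw [lt_div_iff₀' hc₀] at hΓx
  have hΓ₀ : 0 ≤ Γ := zero_le_one.trans hΓ.le
  obtain ⟨g⟩ := Grid.nonempty (Fintype.card (FlipKind (Fin n))) hε hc (mul_nonneg hm₀.le hΓ₀) hΓ₀
    hΓx
  obtain ⟨M, hT, hM⟩ := H g.A (zero_lt_one.trans g.one_lt_A)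
  have hw : 0 < min g.w 1 := lt_min g.w_pos one_pos
  obtain ⟨γ, hγanti, hγ, -⟩ := exists_seq_strictAnti_tendsto' hΓ
  obtain ⟨κ, hκanti, hκ, -⟩ := exists_seq_strictAnti_tendsto' (div_pos hw (mul_pos hc₀ hm₀))
  have hκw (p : ℕ) : c * (m * κ p) < min g.w 1 := by
    rw [← mul_assoc, ← lt_div_iff₀' (mul_pos hc₀ hm₀)]
    exact (hκ p).2
  have hmκ (p : ℕ) : m * κ p ≤ min g.w 1 :=
    (le_mul_of_one_le_left (mul_nonneg hm₀.le (hκ p).1.le) hc).trans (hκw p).le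
  have hκ₁ (p : ℕ) : κ p ≤ 1 :=
    (le_mul_of_one_le_left (hκ p).1.le hm₁).trans ((hmκ p).trans (min_le_right _ _))
  have hcorner := mem_insert_self g.corner g.points
  obtain ⟨s, hs⟩ := Star.exists_rootHoldsAll (k := k) hm hT hM hΓ.le hγanti hκanti
    (fun p => ⟨zero_le_one.trans (hγ p).1.le, (hγ p).2.le⟩) (fun p => ⟨(hκ p).1, hκ₁ p⟩) (hκw 0)
  exact hs.sub_one_le hM hc₀.le (hγ _).1.le (hκ _).1.le
    ((hmκ _).trans ((min_le_left _ _).trans (g.le_of_mem hcorner).1))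
    (fun _ => g.nonneg_of_mem hcorner) fun _ => le_rfl

lemma sub_one_le_sq [NeZero m] (hm : 2 * (n - 1) ≤ m) (k : Fin n) (hε : 0 < ε)
    (H : ∀ E, 0 < E → ∃ M : Mechanism n m,
      M.TruthfulOn (oneMachineDomain k (nearAdditive m ε E)) ∧ M.ApproxOn c (additiveDomain n m)) :
    ((n - 1 : ℕ) : ℝ) ≤ c ^ 2 := by
  obtain ⟨M, -, hM⟩ := H 1 one_pos
  have hc : 1 ≤ c := hM.one_le
  have hc₀ : 0 < c := zero_lt_one.trans_le hc
  rw [sq, ← div_le_iff₀' hc₀]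
  exact le_of_forall_gt_imp_ge_of_dense fun x₀ hx =>
    (div_le_iff₀' hc₀).2 (sub_one_le_mul hm k hε hc hx H)

end LowerBound

/-! ### Domains and units -/

section Domains

variable {n m : ℕ} {M : Mechanism n m} {ε ε' E c d u : ℝ} {k : Fin n} {v : Cost m}
  {D D' : Fin n → Set (Cost m)}

lemma Mechanism.TruthfulOn.mono (hM : M.TruthfulOn D) (h : ∀ i, D' i ⊆ D i) : M.TruthfulOn D' :=
  fun i b hb v hv => hM i b (fun j => h j (hb j)) v (h i hv)

lemma Mechanism.ApproxOn.mono (hM : M.ApproxOn c D) (h : ∀ i, D' i ⊆ D i) : M.ApproxOn c D' :=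
  fun t ht => hM t fun j => h j (ht j)

lemma oneMachineDomain_mono {V V' : Set (Cost m)} (h : V' ⊆ V) (i : Fin n) :
    oneMachineDomain k V' i ⊆ oneMachineDomain k V i :=
  fun _ hv => ⟨fun hi => h (hv.1 hi), hv.2⟩

lemma IsAdditive.isSubmodular (hv : IsAdditive v) : IsSubmodular v :=
  ⟨hv.1, fun S T => by rw [hv.2 (S ∪ T), hv.2 (S ∩ T), hv.2 S, hv.2 T, sum_union_inter]⟩

lemma additiveDomain_subset_submodularDomain (i : Fin n) :
    additiveDomain n m i ⊆ submodularDomain n m i :=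
  fun _ hv => hv.isSubmodular

lemma oneMachineDomain_subset_submodularDomain (k i : Fin n) :
    oneMachineDomain k {v : Cost m | IsSubmodular v} i ⊆ submodularDomain n m i := fun v hv => by
  by_cases hi : i = k
  · exact hv.1 hi
  · exact (hv.2 hi).isSubmodular

section Discount

variable {w : Fin m → ℝ} {a b : Fin m}

lemma discountedCost_singleton (hab : a ≠ b) (j : Fin m) : discountedCost w a b d {j} = w j := by
  have hpair : ¬(a ∈ ({j} : Finset (Fin m)) ∧ b ∈ ({j} : Finset (Fin m))) := fun h =>
    hab ((mem_singleton.1 h.1).trans (mem_singleton.1 h.2).symm)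
  rw [discountedCost, if_neg hpair, sub_zero, additiveCost, sum_singleton]

lemma isCost_discountedCost (hw : 0 ≤ w) (hda : d ≤ w a) (hdb : d ≤ w b) :
    IsCost (discountedCost w a b d) := by
  refine ⟨by simp [discountedCost, additiveCost], fun S T hST => ?_⟩
  have hsum : ∑ τ ∈ T \ S, w τ + ∑ τ ∈ S, w τ = ∑ τ ∈ T, w τ := sum_sdiff hST
  have hnew (j : Fin m) (hT : j ∈ T) (hS : j ∉ S) : w j ≤ ∑ τ ∈ T \ S, w τ :=
    single_le_sum (fun τ _ => hw τ) (mem_sdiff.2 ⟨hT, hS⟩)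
  have hnonneg : 0 ≤ ∑ τ ∈ T \ S, w τ := sum_nonneg fun τ _ => hw τ
  simp only [discountedCost, additiveCost]
  by_cases hS : a ∈ S ∧ b ∈ S
  · rw [if_pos hS, if_pos ⟨hST hS.1, hST hS.2⟩]
    linarith
  rw [if_neg hS]
  split_ifs with hT
  · rcases not_and_or.1 hS with hS | hS
    · linarith [hnew a hT.1 hS]
    · linarith [hnew b hT.2 hS]
  · linarith

lemma isSubmodular_discountedCost (hw : 0 ≤ w) (hd : 0 ≤ d) (hda : d ≤ w a) (hdb : d ≤ w b) :
    IsSubmodular (discountedCost w a b d) := by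
  refine ⟨isCost_discountedCost hw hda hdb, fun S T => ?_⟩
  have hsum := sum_union_inter (s₁ := S) (s₂ := T) (f := w)
  have hdisc : (if a ∈ S ∧ b ∈ S then d else 0) + (if a ∈ T ∧ b ∈ T then d else 0) ≤
      (if a ∈ S ∪ T ∧ b ∈ S ∪ T then d else 0) + if a ∈ S ∩ T ∧ b ∈ S ∩ T then d else 0 := by
    grind
  simp only [discountedCost, additiveCost]
  linarith

end Discount

lemma nearAdditive_mono (h : ε' ≤ ε) : nearAdditive m ε' E ⊆ nearAdditive m ε E := by
  rintro v (hv | ⟨w, a, b, hab, hw, hwE, hwε, rfl⟩)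
  · exact Or.inl hv
  · exact Or.inr ⟨w, a, b, hab, hw, hwE, hwε.trans (mul_le_mul_of_nonneg_right h (hw b)), rfl⟩

lemma isSubmodular_of_mem_nearAdditive (hε : ε ≤ 1) (hv : v ∈ nearAdditive m ε E) :
    IsSubmodular v := by
  rcases hv with hv | ⟨w, a, b, -, hw, -, hwε, rfl⟩
  · exact hv.isSubmodular
  · exact isSubmodular_discountedCost hw (hw a) le_rfl
      (hwε.trans (mul_le_of_le_one_left (hw b) hε))

lemma isEpsAdditive_of_mem_nearAdditive (hE : 0 ≤ E) (hv : v ∈ nearAdditive m ε E) :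
    IsEpsAdditive E v := by
  intro S
  rcases hv with hv | ⟨w, a, b, hab, hw, hwE, -, rfl⟩
  · rw [hv.2 S]
    constructor <;> linarith
  · have hwa : 0 ≤ w a := hw a
    simp only [discountedCost_singleton hab]
    simp only [discountedCost, additiveCost]
    split_ifs <;> constructor <;> linarith

lemma isMulEpsAdditive_of_mem_nearAdditive (hε : 0 ≤ ε) (hv : v ∈ nearAdditive m ε E) :
    IsMulEpsAdditive ε v := by
  intro S
  rcases hv with hv | ⟨w, a, b, hab, hw, -, hwε, rfl⟩
  · have hnonneg : 0 ≤ v S := hv.1.1.symm.trans_le (hv.1.2 _ _ (empty_subset S))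
    rw [← hv.2 S]
    constructor <;> nlinarith
  · have hwa : 0 ≤ w a := hw a
    have hnonneg : 0 ≤ ε * ∑ j ∈ S, w j := mul_nonneg hε (sum_nonneg fun τ _ => hw τ)
    simp only [discountedCost_singleton hab]
    simp only [discountedCost, additiveCost]
    split_ifs with hS
    · have hle : w a ≤ ε * ∑ j ∈ S, w j :=
        hwε.trans (mul_le_mul_of_nonneg_left (single_le_sum (fun τ _ => hw τ) hS.2) hε)
      constructor <;> linarith
    · constructor <;> linarith

lemma makespan_smul (hu : 0 ≤ u) (t : Profile n m) (B : Allocation n m) :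
    makespan (u • t) B = u * makespan t B := by
  simp only [makespan, Pi.smul_apply, smul_eq_mul, Real.mul_iSup_of_nonneg hu]

lemma opt_smul (hu : 0 ≤ u) (t : Profile n m) : opt (u • t) = u * opt t := by
  simp only [opt, makespan_smul hu, Real.mul_iInf_of_nonneg hu]

/-- The mechanism that measures costs and payments in another unit. -/
noncomputable def Mechanism.scale (M : Mechanism n m) (u : ℝ) : Mechanism n m where
  alloc t := M.alloc (u • t)
  pay t i := M.pay (u • t) i / u

lemma Mechanism.TruthfulOn.scale (hM : M.TruthfulOn D) (hu : 0 < u)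
    (hD : ∀ i, ∀ v ∈ D' i, u • v ∈ D i) : (M.scale u).TruthfulOn D' := by
  intro i b hb v hv
  have hutility (v : Cost m) (b : Profile n m) :
      (M.scale u).utility i v b = M.utility i (u • v) (u • b) / u := by
    simp only [Mechanism.utility, Mechanism.scale, Pi.smul_apply, smul_eq_mul]
    field_simp
  rw [hutility, hutility, ← Function.update_smul]
  exact div_le_div_of_nonneg_right
    (hM i (u • b) (fun j => hD j _ (hb j)) (u • v) (hD i v hv)) hu.le

lemma Mechanism.ApproxOn.scale (hM : M.ApproxOn c D) (hu : 0 < u)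
    (hD : ∀ i, ∀ v ∈ D' i, u • v ∈ D i) : (M.scale u).ApproxOn c D' := by
  intro t ht
  have h := hM (u • t) fun j => hD j _ (ht j)
  rw [makespan_smul hu.le, opt_smul hu.le, mul_left_comm] at h
  exact le_of_mul_le_mul_left h hu

lemma IsCost.smul (hv : IsCost v) (hu : 0 ≤ u) : IsCost (u • v) :=
  ⟨by simp [hv.1], fun S T hST => mul_le_mul_of_nonneg_left (hv.2 S T hST) hu⟩

lemma IsAdditive.smul (hv : IsAdditive v) (hu : 0 ≤ u) : IsAdditive (u • v) :=
  ⟨hv.1.smul hu, fun S => by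
    simp only [Pi.smul_apply, smul_eq_mul, ← mul_sum]
    rw [hv.2 S]⟩

lemma IsSubmodular.smul (hv : IsSubmodular v) (hu : 0 ≤ u) : IsSubmodular (u • v) :=
  ⟨hv.1.smul hu, fun S T => by
    simpa only [Pi.smul_apply, smul_eq_mul, mul_add] using
      mul_le_mul_of_nonneg_left (hv.2 S T) hu⟩

lemma IsEpsAdditive.smul (hv : IsEpsAdditive E v) (hu : 0 ≤ u) :
    IsEpsAdditive (u * E) (u • v) := fun S => by
  simpa only [Pi.smul_apply, smul_eq_mul, ← mul_sum, ← mul_sub, ← mul_add] using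
    ⟨mul_le_mul_of_nonneg_left (hv S).1 hu, mul_le_mul_of_nonneg_left (hv S).2 hu⟩

end Domains

section Conclusion

variable {n m : ℕ} {M : Mechanism n m} {ε c : ℝ} {k : Fin n}

lemma sqrt_le_of_nearAdditive (hn : 2 ≤ n) (hm : 2 * (n - 1) ≤ m) (k : Fin n) (hε : 0 < ε)
    (H : ∀ E, 0 < E → ∃ M : Mechanism n m,
      M.TruthfulOn (oneMachineDomain k (nearAdditive m ε E)) ∧ M.ApproxOn c (additiveDomain n m)) :
    √((n : ℝ) - 1) ≤ c := by
  have : NeZero m := ⟨by omega⟩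
  obtain ⟨M, -, hM⟩ := H 1 one_pos
  have hsq := sub_one_le_sq hm k hε H
  rw [Nat.cast_sub (by omega), Nat.cast_one] at hsq
  exact Real.sqrt_le_iff.2 ⟨zero_le_one.trans hM.one_le, hsq⟩

lemma sqrt_le_of_isSubmodular (hn : 2 ≤ n) (hm : 2 * (n - 1) ≤ m)
    (hT : M.TruthfulOn (oneMachineDomain k {v | IsSubmodular v}))
    (hM : M.ApproxOn c (additiveDomain n m)) : √((n : ℝ) - 1) ≤ c :=
  sqrt_le_of_nearAdditive hn hm k one_pos fun _ _ =>
    ⟨M, hT.mono (oneMachineDomain_mono fun _ => isSubmodular_of_mem_nearAdditive le_rfl), hM⟩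

lemma sqrt_le_of_isMulEpsAdditive (hn : 2 ≤ n) (hm : 2 * (n - 1) ≤ m) (hε : 0 < ε)
    (hT : M.TruthfulOn (oneMachineDomain k {v | IsSubmodular v ∧ IsMulEpsAdditive ε v}))
    (hM : M.ApproxOn c (additiveDomain n m)) : √((n : ℝ) - 1) ≤ c := by
  have hε' : 0 < min ε 1 := lt_min hε one_pos
  refine sqrt_le_of_nearAdditive hn hm k hε' fun E _ =>
    ⟨M, hT.mono (oneMachineDomain_mono fun v hv => ?_), hM⟩
  exact ⟨isSubmodular_of_mem_nearAdditive (min_le_right _ _) hv,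
    isMulEpsAdditive_of_mem_nearAdditive hε.le (nearAdditive_mono (min_le_left _ _) hv)⟩

/-- A change of units makes any additive error as small as desired. -/
lemma sqrt_le_of_isEpsAdditive (hn : 2 ≤ n) (hm : 2 * (n - 1) ≤ m) (hε : 0 < ε)
    (hT : M.TruthfulOn (oneMachineDomain k {v | IsSubmodular v ∧ IsEpsAdditive ε v}))
    (hM : M.ApproxOn c (additiveDomain n m)) : √((n : ℝ) - 1) ≤ c := by
  refine sqrt_le_of_nearAdditive hn hm k one_pos fun E hE => ?_
  have hu : 0 < ε / E := div_pos hε hE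
  refine ⟨M.scale (ε / E), hT.scale hu fun i v hv => ⟨fun hi => ?_, fun hi => (hv.2 hi).smul hu.le⟩,
    hM.scale hu fun _ v hv => hv.smul hu.le⟩
  have heps := (isEpsAdditive_of_mem_nearAdditive hE.le (hv.1 hi)).smul hu.le
  rw [div_mul_cancel₀ _ hE.ne'] at heps
  exact ⟨(isSubmodular_of_mem_nearAdditive le_rfl (hv.1 hi)).smul hu.le, heps⟩

end Conclusion

end Scheduling

theorem theorem1 (n m : ℕ) (hn : 2 ≤ n) (hm : 2 * (n - 1) ≤ m)
    (M : Scheduling.Mechanism n m) (c : ℝ) :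
    -- truthful for submodular machines, ratio on submodular instances
    (M.TruthfulOn (Scheduling.submodularDomain n m) →
      M.ApproxOn c (Scheduling.submodularDomain n m) →
      Real.sqrt ((n : ℝ) - 1) ≤ c) ∧
    -- truthful when one machine is submodular and the others additive, ratio on additive instances
    (∀ k : Fin n,
      M.TruthfulOn (Scheduling.oneMachineDomain k {v | Scheduling.IsSubmodular v}) →
      M.ApproxOn c (Scheduling.additiveDomain n m) →
      Real.sqrt ((n : ℝ) - 1) ≤ c) ∧
    -- the same, with the submodular machine within `ε` of being additive
    (∀ (k : Fin n) (ε : ℝ), 0 < ε →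
      M.TruthfulOn (Scheduling.oneMachineDomain k
        {v | Scheduling.IsSubmodular v ∧ Scheduling.IsEpsAdditive ε v}) →
      M.ApproxOn c (Scheduling.additiveDomain n m) →
      Real.sqrt ((n : ℝ) - 1) ≤ c) ∧
    -- the same, with the submodular machine within a factor `1 ± ε` of being additive
    (∀ (k : Fin n) (ε : ℝ), 0 < ε →
      M.TruthfulOn (Scheduling.oneMachineDomain k
        {v | Scheduling.IsSubmodular v ∧ Scheduling.IsMulEpsAdditive ε v}) →
      M.ApproxOn c (Scheduling.additiveDomain n m) →
      Real.sqrt ((n : ℝ) - 1) ≤ c) := by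
  refine ⟨fun hT hM => ?_, fun k hT hM => ?_, fun k ε hε hT hM => ?_, fun k ε hε hT hM => ?_⟩
  · exact Scheduling.sqrt_le_of_isSubmodular (k := ⟨0, by omega⟩) hn hm
      (hT.mono (Scheduling.oneMachineDomain_subset_submodularDomain _))
      (hM.mono Scheduling.additiveDomain_subset_submodularDomain)
  · exact Scheduling.sqrt_le_of_isSubmodular hn hm hT hM
  · exact Scheduling.sqrt_le_of_isEpsAdditive hn hm hε hT hM
  · exact Scheduling.sqrt_le_of_isMulEpsAdditive hn hm hε hT hM
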